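/- **Setting.** Fix $u\ge 0$, $\beta_0\in\mathbb R^{u+1}$, $0<a\le 1$, $0\le\rho<1$ and $1\le p<\infty$. For a sequence of unit grids of sizes $m\times n$ with $N=mn\to\infty$ (all of the following may depend on the grid), let $s_1,\dots,s_N$ be the sites, let $T$ be a non-random design matrix whose $i$th row is $t_i=(1,t_{i1},\dots,t_{iu})$ with $t_{ij}\in\{0,1\}$, and let $Y=(Y(s_1),\dots,Y(s_N))^T$ be $\{0,1\}$-valued random variables. Put $$\theta_i(\beta)=\frac{\exp(t_i^T\beta)}{1+\exp(t_i^T\beta)},\qquad \sigma_i(\beta)=\sqrt{\theta_i(\beta)(1-\theta_i(\beta))},\qquad P(\beta)=\frac{\partial\theta}{\partial\beta},\qquad V(\beta)=\big(\sigma_i(\beta)\sigma_j(\beta)\gamma_{ij}\big)_{ij},$$ where $\gamma_{ii}=1$ and $\gamma_{ij}=a\rho^{d(s_i,s_j)}$ for $i\ne j$, $d$ being the $L_p$ distance. The quasi-score function is $U(\beta)=P(\beta)^TV(\beta)^{-1}(Y-\theta(\beta))$. **Assumptions.** * $E\,Y(s_i)=\theta_i(\beta_0)$ for all $i$, and $\operatorname{corr}(Y(s_i),Y(s_j))=a\rho^{d(s_i,s_j)}$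 for all $i\neq j$. * For every $k\ge 3$ there is $\alpha_k<k/2$ such that $\sum c_k(s_{i_1},\dots,s_{i_k})=O(N^{\alpha_k})$, where the sum runs over all $k$-tuples of pairwise distinct indices and $c_k(s_{i_1},\dots,s_{i_k})$ is the joint cumulant of the centred variables $Y(s_{i_1})-\theta_{i_1}(\beta_0),\dots,Y(s_{i_k})-\theta_{i_k}(\beta_0)$. * $\frac1N D_\beta U(\beta_0)$ is negative definite, uniformly in $N$, with probability tending to $1$: there is $c>0$ such that, with probability tending to $1$ as $N\to\infty$, $\frac1N v^TD_\beta U(\beta_0)v\le -c\|v\|^2$ for all $v\in\mathbb R^{u+1}$. **Corollary 2.1.** There is $r_0>0$ such that the following holds for every $0<r\le r_0$. For each grid of the sequence let $\hat\beta$ be a quasi-likelihood estimate near $\beta_0$, that is, a random vector which almost surely, whenever the equation $U(\beta)=0$ has a root in the open ball $B(\beta_0,r)$, is such a root; where there is no such root the value of $\hat\beta$ is arbitrary. Assume that the vectors $\hat\beta$ are almost surely bounded, uniformly along the sequence. Then $\hat\beta$ is integrable and its bias is of order $1/N$: $$E(\hat\beta-\beta_0)=O\!\left(\tfrac1N\right)\qquad\text{as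 } N\to\infty .$$ -/

import Mathlib

open Filter Topology MeasureTheory ProbabilityTheory
open scoped Matrix Nat

namespace BinarySpatial

/-- The sites of an `m × n` unit grid. -/
abbrev Site (m n : ℕ) : Type := Fin m × Fin n

/-- The `L_p` distance between two sites, seen as points of the plane with integer coordinates. -/
noncomputable def lpDist (p : ℝ) {m n : ℕ} (s s' : Site m n) : ℝ :=
  (|((s.1 : ℕ) : ℝ) - ((s'.1 : ℕ) : ℝ)| ^ p + |((s.2 : ℕ) : ℝ) - ((s'.2 : ℕ) : ℝ)| ^ p) ^ (1 / p)

/-- The correlation matrix with entries `γ_ij = a ρ ^ d(s_i, s_j)` off the diagonal and `1` on it. -/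
noncomputable def corrMatrix (a ρ p : ℝ) (m n : ℕ) : Matrix (Site m n) (Site m n) ℝ :=
  Matrix.of fun s s' => if s = s' then 1 else a * ρ ^ lpDist p s s'

/-- A design matrix whose `i`th row is `(1, t_i1, …, t_iu)` with `t_ij ∈ {0, 1}`. -/
def IsBinaryDesign {m n u : ℕ} (T : Matrix (Site m n) (Fin (u + 1)) ℝ) : Prop :=
  ∀ s, T s 0 = 1 ∧ ∀ j, T s j = 0 ∨ T s j = 1

section Model

variable {m n u : ℕ} (T : Matrix (Site m n) (Fin (u + 1)) ℝ) (β : EuclideanSpace ℝ (Fin (u + 1)))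

/-- The mean responses under the logistic link, `logit θ = T β`. -/
noncomputable def theta (s : Site m n) : ℝ :=
  Real.exp (∑ j, T s j * β j) / (1 + Real.exp (∑ j, T s j * β j))

/-- The standard deviation `σ_i = √(θ_i (1 - θ_i))` of a binary response with mean `θ_i`. -/
noncomputable def sigma (s : Site m n) : ℝ :=
  Real.sqrt (theta T β s * (1 - theta T β s))

/-- The derivative matrix `P = ∂θ/∂β`. -/
noncomputable def derivMatrix : Matrix (Site m n) (Fin (u + 1)) ℝ :=
  Matrix.of fun s j => T s j * (theta T β s * (1 - theta T β s))

/-- The covariance matrix `V`, with entries `σ_i σ_j γ_ij`. -/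
noncomputable def covMatrix (a ρ p : ℝ) : Matrix (Site m n) (Site m n) ℝ :=
  Matrix.of fun s s' => sigma T β s * sigma T β s' * corrMatrix a ρ p m n s s'

/-- The quasi-score function `U(β; y) = Pᵀ V⁻¹ (y - θ(β))`. -/
noncomputable def quasiScore (a ρ p : ℝ) (y : Site m n → ℝ) : EuclideanSpace ℝ (Fin (u + 1)) :=
  WithLp.toLp 2 (((derivMatrix T β)ᵀ * (covMatrix T β a ρ p)⁻¹) *ᵥ (y - theta T β))

end Model

/-- The correlation coefficient of two square integrable random variables. -/
noncomputable def corr {Ω : Type*} [MeasurableSpace Ω] (X Y : Ω → ℝ) (μ : Measure Ω) : ℝ :=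
  cov[X, Y; μ] / (Real.sqrt Var[X; μ] * Real.sqrt Var[Y; μ])

/-- The joint cumulant of `X_1, …, X_k`: the sum over all partitions `π` of the index set of
`(-1) ^ (|π| - 1) (|π| - 1)! ∏_{B ∈ π} E ∏_{i ∈ B} X_i` (for `k ≥ 1`, so that `|π| ≥ 1`). -/
noncomputable def jointCumulant {Ω : Type*} [MeasurableSpace Ω] (μ : Measure Ω) {k : ℕ}
    (X : Fin k → Ω → ℝ) : ℝ :=
  ∑ π : Finpartition (Finset.univ : Finset (Fin k)),
    (-1 : ℝ) ^ (π.parts.card - 1) * ((π.parts.card - 1)! : ℝ) *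
      ∏ B ∈ π.parts, ∫ ω, ∏ i ∈ B, X i ω ∂μ

/-- The sum of the `k`th order joint cumulants `c_k(s_{i_1}, …, s_{i_k})` of a field `Z` over all
`k`-tuples of pairwise distinct sites. -/
noncomputable def cumulantSum {Ω : Type*} [MeasurableSpace Ω] (μ : Measure Ω) {m n : ℕ}
    (Z : Site m n → Ω → ℝ) (k : ℕ) : ℝ :=
  ∑ i : Fin k ↪ Site m n, jointCumulant μ fun l => Z (i l)

/-- `b` is a quasi-likelihood estimate within distance `r` of the true parameter `β₀`: almost
surely it is a root, in the ball, of the quasi-score at the observed responses, whenever there is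
such a root. -/
def IsQLEstimate {Ω : Type*} [MeasurableSpace Ω] (μ : Measure Ω) {m n u : ℕ}
    (T : Matrix (Site m n) (Fin (u + 1)) ℝ) (a ρ p : ℝ) (Y : Site m n → Ω → ℝ)
    (β₀ : EuclideanSpace ℝ (Fin (u + 1))) (r : ℝ) (b : Ω → EuclideanSpace ℝ (Fin (u + 1))) : Prop :=
  AEMeasurable b μ ∧ ∀ᵐ ω ∂μ,
    (∃ β ∈ Metric.ball β₀ r, quasiScore T β a ρ p (fun s => Y s ω) = 0) →
      b ω ∈ Metric.ball β₀ r ∧ quasiScore T (b ω) a ρ p (fun s => Y s ω) = 0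

end BinarySpatial

/-! Divide the quasi-score by N and write its derivative at `β₀` as D + W, with D non-random and W
centred. Two facts suffice: U(β₀)/N and W have second moments O(1/N), and any estimate satisfies,
pointwise, that b - β₀ + D⁻¹U(β₀)/N is at most a constant times the sum of the squared norms of W
and U(β₀)/N. Since D is non-random and U(β₀) is centred, the linear term has mean zero, so taking
expectations leaves a bias O(1/N).

The pointwise bound is `exists_root_expansion`. When W and U(β₀)/N are small, a quantitative inverse
function argument produces a root in the ball, and coercivity controls every root there. Otherwise
the quadratic right-hand side is bounded below, so boundedness of the estimate is enough. Thus the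
exceptional set needs no separate tail estimate.

The constants must not depend on the grid. Writing the covariance as SΓS, with S the diagonal of
standard deviations, turns each score component into a bilinear form in Γ⁻¹ whose two entries are
elementary functions of the linear predictors (`quasiScore_apply`). All estimates then reduce to
scalar Taylor bounds and to uniform spectral bounds for Γ. The upper spectral bound is a row-sum
estimate.

The lower bound is the deepest ingredient. On integer points the L_p norm of the plane is a positive
combination of absolute values of integral linear forms, so Schur products make exp(-μ‖·‖_p)
positive semidefinite for every μ > 0. Its Fourier symbol is therefore nonnegative. A zero for one μ
would propagate to smaller μ by the convolution semigroup law and then to all μ by analyticity,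
contradicting the limit 1 as μ → ∞. Strict positivity on the compact torus supplies a positive
minimum, valid for every finite grid. -/

namespace BinarySpatial

/-! ### Planar norms as sums of absolute values -/

/-- A norm on the plane, symmetric in the first coordinate and normalised on the first axis. -/
structure IsAxialNorm (q : ℝ → ℝ → ℝ) : Prop where
  add_le : ∀ x y x' y', q (x + x') (y + y') ≤ q x y + q x' y'
  smul : ∀ c x y, q (c * x) (c * y) = |c| * q x y
  axis : ∀ x, q x 0 = |x|
  neg_fst : ∀ x y, q (-x) y = q x y

theorem abs_second_difference (i : ℤ) : |i + 1| + |i - 1| - 2 * |i| = if i = 0 then 2 else 0 := by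
  split_ifs with h
  · subst h; simp
  · (simp only [Int.abs_eq_natAbs] at *; omega)

/-- Summation by parts against the second difference of `|k - i|`. -/
theorem sum_second_difference (F : ℤ → ℝ) (hF : ∀ i, F (-i) = F i) (k : ℤ) (L : ℕ) :
    ∑ i ∈ Finset.Icc (-L : ℤ) L, (F (i + 1) - 2 * F i + F (i - 1)) * ((|k - i| : ℤ) : ℝ)
      = (if |k| ≤ L then 2 * F k else 0)
        + (((|k - L| : ℤ) : ℝ) + ((|k + L| : ℤ) : ℝ)) * F (L + 1)
        - (((|k - L - 1| : ℤ) : ℝ) + ((|k + L + 1| : ℤ) : ℝ)) * F L := by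
  induction L with
  | zero =>
    have h1 := abs_second_difference k
    have hz : F (-1) = F 1 := hF 1
    by_cases hk : k = 0
    · subst hk; simp [hz]; ring
    · have hk' : ¬ |k| ≤ 0 := by simpa using hk
      simp only [hk, if_false] at h1
      have h2 : ((|k + 1| : ℤ) : ℝ) + ((|k - 1| : ℤ) : ℝ) - 2 * ((|k| : ℤ) : ℝ) = 0 := by
        exact_mod_cast h1
      simp only [Nat.cast_zero, neg_zero, Finset.Icc_self, Finset.sum_singleton, zero_add,
        zero_sub, hz, sub_zero, add_zero, hk', if_false]
      linear_combination (F 0) * h2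
  | succ L ih =>
    have hset : Finset.Icc (-(L + 1 : ℕ) : ℤ) (L + 1 : ℕ)
        = insert (L + 1 : ℤ) (insert (-(L + 1) : ℤ) (Finset.Icc (-L : ℤ) L)) := by
      ext i; simp only [Finset.mem_Icc, Finset.mem_insert]; push_cast; omega
    rw [hset, Finset.sum_insert (by simp only [Finset.mem_Icc, Finset.mem_insert]; omega),
      Finset.sum_insert (by simp only [Finset.mem_Icc]; omega), ih]
    have e1 : F (-(L + 1) + 1) = F L := by rw [← hF]; congr 1; ring
    have e2 : F (-(L + 1)) = F (L + 1) := hF _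
    have e3 : F (-(L + 1) - 1) = F (L + 1 + 1) := by rw [← hF]; congr 1
    have e4 : F (L + 1 - 1) = F L := by congr 1; ring
    rw [e1, e2, e3, e4]
    have h1 := abs_second_difference (k - (L + 1))
    have h2 := abs_second_difference (k + (L + 1))
    have a1 : k - (L + 1) + 1 = k - L := by ring
    have a2 : k - (L + 1) - 1 = k - (L + 1 : ℕ) - 1 := by push_cast; ring
    have a3 : k + (L + 1) + 1 = k + (L + 1 : ℕ) + 1 := by push_cast; ring
    have a4 : k + (L + 1) - 1 = k + L := by ring
    rw [a1, a2] at h1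
    rw [a3, a4] at h2
    have b1 : k - L - 1 = k - (L + 1) := by ring
    have b2 : k + L + 1 = k + (L + 1) := by ring
    have b3 : k - -(L + 1 : ℤ) = k + (L + 1) := by ring
    rw [b1, b2, b3]
    have hc1 : (k - (L + 1 : ℕ) : ℤ) = k - (L + 1) := by push_cast; ring
    have hc2 : (k + (L + 1 : ℕ) : ℤ) = k + (L + 1) := by push_cast; ring
    rw [hc1] at h1 ⊢
    rw [hc2] at h2 ⊢
    have h1' : ((|k - L| : ℤ) : ℝ) + ((|k - (L + 1) - 1| : ℤ) : ℝ) - 2 * ((|k - (L + 1)| : ℤ) : ℝ)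
      = if k - (L + 1) = 0 then 2 else 0 := by
      exact_mod_cast congrArg (Int.cast : ℤ → ℝ) h1
    have h2' : ((|k + (L + 1) + 1| : ℤ) : ℝ) + ((|k + L| : ℤ) : ℝ) - 2 * ((|k + (L + 1)| : ℤ) : ℝ)
      = if k + (L + 1) = 0 then 2 else 0 := by
      exact_mod_cast congrArg (Int.cast : ℤ → ℝ) h2
    push_cast at h1' h2' ⊢
    -- The indicator |k| ≤ L changes only at k = ±(L + 1), exactly where one of the two new second
    -- differences is 2 instead of 0.
    by_cases k1 : k = L + 1
    · have q1 : ¬ |k| ≤ (L : ℤ) := by (simp only [Int.abs_eq_natAbs] at *; omega)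
      have q2 : |k| ≤ (L + 1 : ℤ) := by (simp only [Int.abs_eq_natAbs] at *; omega)
      have q3 : k - (L + 1) = 0 := by omega
      have q4 : ¬ k + (L + 1) = 0 := by omega
      rw [if_pos q3] at h1'
      rw [if_neg q4] at h2'
      rw [if_neg q1, if_pos q2]
      have q5 : F k = F (L + 1) := by rw [k1]
      rw [q5]
      linear_combination (F (L + 1)) * h1' + (F (L + 1)) * h2'
    by_cases k2 : k = -(L + 1)
    · have q1 : ¬ |k| ≤ (L : ℤ) := by (simp only [Int.abs_eq_natAbs] at *; omega)
      have q2 : |k| ≤ (L + 1 : ℤ) := by (simp only [Int.abs_eq_natAbs] at *; omega)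
      have q3 : ¬ k - (L + 1) = 0 := by omega
      have q4 : k + (L + 1) = 0 := by omega
      rw [if_neg q3] at h1'
      rw [if_pos q4] at h2'
      rw [if_neg q1, if_pos q2]
      have q5 : F k = F (L + 1) := by rw [k2, hF]
      rw [q5]
      linear_combination (F (L + 1)) * h1' + (F (L + 1)) * h2'
    · have q3 : ¬ k - (L + 1) = 0 := by omega
      have q4 : ¬ k + (L + 1) = 0 := by omega
      rw [if_neg q3] at h1'
      rw [if_neg q4] at h2'
      have q6 : (if |k| ≤ (L + 1 : ℤ) then 2 * F k else 0) = if |k| ≤ (L : ℤ) then 2 * F k else 0 := by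
        have : |k| ≤ (L + 1 : ℤ) ↔ |k| ≤ (L : ℤ) := by (simp only [Int.abs_eq_natAbs] at *; omega)
        simp only [this]
      rw [q6]
      linear_combination (F (L + 1)) * h1' + (F (L + 1)) * h2'

/-- The sum collapses to the difference of the end slopes, which evenness makes opposite. It serves
the axis y = 0, where every linear form reduces to a multiple of x. -/
theorem sum_second_difference_telescope (F : ℤ → ℝ) (hF : ∀ i, F (-i) = F i) (L : ℕ) :
    ∑ i ∈ Finset.Icc (-L : ℤ) L, (F (i + 1) - 2 * F i + F (i - 1)) = 2 * (F (L + 1) - F L) := by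
  induction L with
  | zero =>
    have hz : F (-1) = F 1 := hF 1
    simp [hz]; ring
  | succ L ih =>
    have hset : Finset.Icc (-(L + 1 : ℕ) : ℤ) (L + 1 : ℕ)
        = insert (L + 1 : ℤ) (insert (-(L + 1) : ℤ) (Finset.Icc (-L : ℤ) L)) := by
      ext i; simp only [Finset.mem_Icc, Finset.mem_insert]; push_cast; omega
    rw [hset, Finset.sum_insert (by simp only [Finset.mem_Icc, Finset.mem_insert]; omega),
      Finset.sum_insert (by simp only [Finset.mem_Icc]; omega), ih]
    have e1 : F (-(L + 1) + 1) = F L := by rw [← hF]; congr 1; ring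
    have e2 : F (-(L + 1)) = F (L + 1) := hF _
    have e3 : F (-(L + 1) - 1) = F (L + 1 + 1) := by rw [← hF]; congr 1
    have e4 : F (L + 1 - 1) = F L := by congr 1; ring
    rw [e1, e2, e3, e4]
    push_cast
    ring

/-- On the integer points of a square, an axial norm is a positive combination of absolute values
of integral linear forms. -/
theorem IsAxialNorm.exists_sum_abs {q : ℝ → ℝ → ℝ} (hq : IsAxialNorm q) (n : ℕ) :
    ∃ (I : Finset ℤ) (w₀ : ℝ) (w : ℤ → ℝ) (M : ℤ), 0 ≤ w₀ ∧ (∀ i ∈ I, 0 ≤ w i) ∧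
      ∀ x y : ℤ, |x| ≤ n → |y| ≤ n →
        q x y = w₀ * ((|y| : ℤ) : ℝ) + ∑ i ∈ I, w i * ((|x * M - y * i| : ℤ) : ℝ) := by
  -- Every nonzero y with |y| ≤ n divides n!, so (x, y) can be rescaled to an integer point (x z, M)
  -- at the common height M = y z; then |x z| ≤ n · n! = L. The norm is thus encoded by its
  -- restriction to a single horizontal line.
  set M : ℤ := ((n ! : ℕ) : ℤ) with hM
  have hMpos : 0 < M := by rw [hM]; exact_mod_cast Nat.factorial_pos n
  set L : ℕ := n * n ! with hL
  set F₀ : ℤ → ℝ := fun i => q i M with hF₀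
  -- Beyond L the restriction is continued with slope exactly 1. This keeps it convex, because the
  -- slope of q along the first axis is at most 1, and it gives the second differences total mass 2,
  -- which is what q x 0 = |x| requires.
  set F : ℤ → ℝ := fun i => if |i| ≤ L then F₀ i else F₀ L + ((|i| - L : ℤ) : ℝ) with hFdef
  have hF₀even : ∀ i, F₀ (-i) = F₀ i := by
    intro i; simp only [hF₀]; push_cast; exact hq.neg_fst _ _
  have hFeven : ∀ i, F (-i) = F i := by
    intro i; simp only [hFdef, abs_neg, hF₀even]
  have hconv : ∀ i, 0 ≤ F₀ (i + 1) - 2 * F₀ i + F₀ (i - 1) := by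
    intro i
    have h1 := hq.add_le ((i + 1 : ℤ) : ℝ) M ((i - 1 : ℤ) : ℝ) M
    have h2 := hq.smul 2 i M
    have h3 : ((i + 1 : ℤ) : ℝ) + ((i - 1 : ℤ) : ℝ) = 2 * i := by push_cast; ring
    rw [h3, ← two_mul, h2, abs_two] at h1
    simp only [hF₀]
    linarith
  have hlip : ∀ i, F₀ (i + 1) ≤ F₀ i + 1 := by
    intro i
    have h1 := hq.add_le (i : ℝ) M 1 0
    rw [hq.axis, abs_one, add_zero] at h1
    simpa [hF₀] using h1
  have hge : ∀ i, ((|i| : ℤ) : ℝ) ≤ F₀ i := by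
    intro i
    have h1 := hq.add_le (i : ℝ) M i (-M)
    have h2 : q i (-M) = q i M := by
      have := hq.smul (-1) (-i) M
      rw [abs_neg, abs_one, one_mul, hq.neg_fst] at this
      rw [← this]; ring_nf
    rw [h2, add_neg_cancel, hq.axis, ← two_mul, abs_mul, abs_two] at h1
    simp only [hF₀]; push_cast; linarith
  have hFL : F L = F₀ L := by simp [hFdef]
  have hFL1 : F (L + 1) = F₀ L + 1 := by
    have : ¬ |(L + 1 : ℤ)| ≤ L := by (rw [abs_of_nonneg (by positivity)]; omega)
    have h2 : |(L + 1 : ℤ)| - L = 1 := by (rw [abs_of_nonneg (by positivity)]; omega)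
    simp only [hFdef, this, if_false, h2, Int.cast_one]
  have hFconv : ∀ i ∈ Finset.Icc (-L : ℤ) L, 0 ≤ F (i + 1) - 2 * F i + F (i - 1) := by
    intro i hi
    rw [Finset.mem_Icc] at hi
    have hFle : ∀ j, |j| ≤ (L : ℤ) + 1 → F₀ j ≤ F j := by
      intro j hj
      by_cases h : |j| ≤ L
      · simp [hFdef, h]
      · have h1 : |j| - L = 1 := by omega
        simp only [hFdef, h, if_false, h1]
        have h2 : F₀ j = F₀ (L + 1) := by
          rcases abs_cases j with ⟨h3, _⟩ | ⟨h3, _⟩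
          · congr 1; omega
          · rw [← hF₀even]; congr 1; omega
        rw [h2]; push_cast; exact hlip _
    have h1 : F i = F₀ i := by
      have : |i| ≤ L := by rw [abs_le]; exact hi
      simp [hFdef, this]
    have h2 := hFle (i + 1) (by rw [abs_le]; omega)
    have h3 := hFle (i - 1) (by rw [abs_le]; omega)
    have h4 := hconv i
    rw [h1]; linarith
  have hMR : (0 : ℝ) < M := by exact_mod_cast hMpos
  -- For |k| ≤ L the boundary terms in `sum_second_difference` add up to 2(L - F₀ L). Hence F k is
  -- F₀ L - L plus half the weighted sum of |k - i|, and scaling by |y| / M yields these weights.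
  refine ⟨Finset.Icc (-L : ℤ) L, (F₀ L - L) / M,
    fun i => (F (i + 1) - 2 * F i + F (i - 1)) / (2 * M), M, ?_, ?_, ?_⟩
  · have := hge L
    rw [abs_of_nonneg (by positivity)] at this
    exact div_nonneg (by push_cast at this; linarith) hMR.le
  · intro i hi
    exact div_nonneg (hFconv i hi) (by positivity)
  · intro x y hx hy
    by_cases hy0 : y = 0
    · subst hy0
      have ht := sum_second_difference_telescope F hFeven L
      rw [hFL, hFL1] at ht
      simp only [abs_zero, Int.cast_zero, mul_zero, zero_add, zero_mul, sub_zero]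
      rw [hq.axis, ← Finset.sum_mul, ← Finset.sum_div, ht, abs_mul]
      rw [abs_of_pos hMpos]
      push_cast
      field_simp
      ring
    · have hdvd : y ∣ M := by
        rw [hM, ← Int.natAbs_dvd_natAbs, Int.natAbs_natCast]
        exact Nat.dvd_factorial (by omega) (by rw [Int.abs_eq_natAbs] at hy; omega)
      obtain ⟨z, hz⟩ := hdvd
      have hzM : |z| ≤ M := by
        rw [← abs_of_pos hMpos, hz, abs_mul]
        have h1 : 1 ≤ |y| := Int.one_le_abs hy0
        nlinarith [abs_nonneg z]
      have hkL : |x * z| ≤ L := by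
        rw [abs_mul, hL]; push_cast; rw [← hM]
        exact mul_le_mul hx hzM (abs_nonneg _) (by positivity)
      have hs := sum_second_difference F hFeven (x * z) L
      rw [if_pos hkL, hFL, hFL1] at hs
      have hkk := abs_le.1 hkL
      have d1 : |x * z - L| = L - x * z := by rw [abs_of_nonpos] <;> omega
      have d2 : |x * z + L| = L + x * z := by rw [abs_of_nonneg] <;> omega
      have d3 : |x * z - L - 1| = L + 1 - x * z := by rw [abs_of_nonpos] <;> omega
      have d4 : |x * z + L + 1| = L + 1 + x * z := by rw [abs_of_nonneg] <;> omega
      have hFk : F (x * z) = F₀ (x * z) := by simp only [hFdef, hkL, if_true]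
      rw [d1, d2, d3, d4, hFk] at hs
      have hterm : ∀ i ∈ Finset.Icc (-L : ℤ) L,
          (F (i + 1) - 2 * F i + F (i - 1)) / (2 * M) * ((|x * M - y * i| : ℤ) : ℝ)
          = ((|y| : ℤ) : ℝ) / (2 * M) *
            ((F (i + 1) - 2 * F i + F (i - 1)) * ((|x * z - i| : ℤ) : ℝ)) := by
        intro i _
        have : x * M - y * i = y * (x * z - i) := by rw [hz]; ring
        rw [this, abs_mul]; push_cast; ring
      rw [Finset.sum_congr rfl hterm, ← Finset.mul_sum, hs]
      have hyR : (y : ℝ) ≠ 0 := by exact_mod_cast hy0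
      have hq1 := hq.smul y ((x * z : ℤ)) M
      have hq2 := hq.smul M x y
      have e1 : (y : ℝ) * ((x * z : ℤ) : ℝ) = M * x := by rw [hz]; push_cast; ring
      have e2 : (y : ℝ) * M = M * y := by ring
      rw [e1, e2, hq2, abs_of_pos hMR] at hq1
      have : q x y = |(y : ℝ)| / M * F₀ (x * z) := by
        rw [hF₀]; field_simp; rw [mul_comm, hq1]
      rw [this]; push_cast
      field_simp
      ring

/-! ### Positive semidefinite exponential kernels -/

theorem posSemidef_of_sum_nonneg {ι : Type*} [Fintype ι] {A : Matrix ι ι ℝ}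
    (hs : ∀ i j, A i j = A j i) (h : ∀ x : ι → ℝ, 0 ≤ ∑ i, ∑ j, x i * x j * A i j) :
    A.PosSemidef := by
  refine Matrix.PosSemidef.of_dotProduct_mulVec_nonneg ?_ fun x => ?_
  · ext i j; simp [hs i j]
  · have := h x
    simp only [dotProduct, Matrix.mulVec, star_trivial, Finset.mul_sum]
    refine this.trans_eq ?_
    exact Finset.sum_congr rfl fun i _ => Finset.sum_congr rfl fun j _ => by ring

theorem PosSemidef.sum_nonneg {ι : Type*} [Fintype ι] {A : Matrix ι ι ℝ} (hA : A.PosSemidef)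
    (x : ι → ℝ) : 0 ≤ ∑ i, ∑ j, x i * x j * A i j := by
  have := hA.dotProduct_mulVec_nonneg x
  simp only [dotProduct, Matrix.mulVec, star_trivial, Finset.mul_sum] at this
  refine this.trans_eq ?_
  exact Finset.sum_congr rfl fun i _ => Finset.sum_congr rfl fun j _ => by ring

/-- The exponential kernel on the integers is positive semidefinite. -/
theorem posSemidef_exp_abs {ι : Type*} [Fintype ι] (c : ℝ) (hc : 0 ≤ c) (z : ι → ℤ) :
    (Matrix.of fun j k => Real.exp (-(c * ((|z j - z k| : ℤ) : ℝ)))).PosSemidef := by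
  obtain ⟨B, hB⟩ : ∃ B : ℕ, ∀ j, |z j| ≤ B := by
    refine ⟨∑ j, (z j).natAbs, fun j => ?_⟩
    have := Finset.single_le_sum (f := fun j => (z j).natAbs) (fun _ _ => Nat.zero_le _)
      (Finset.mem_univ j)
    rw [Int.abs_eq_natAbs]
    exact_mod_cast this
  refine posSemidef_of_sum_nonneg (fun i j => by simp [abs_sub_comm]) fun x => ?_
  -- After a shift to nonnegative integers, |a - b| = a + b - 2 min(a, b). The kernel is then a rank
  -- one factor times g(min(a, b)), and the increments of the increasing g express it through
  -- products of indicators, hence as a sum of squares.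
  set a : ι → ℕ := fun j => (z j + B).toNat with ha
  have haz : ∀ j, (a j : ℤ) = z j + B := by
    intro j; have := abs_le.1 (hB j); simp only [ha]; omega
  set g : ℕ → ℝ := fun t => Real.exp (2 * c * t) with hg
  have hker : ∀ j k, Real.exp (-(c * ((|z j - z k| : ℤ) : ℝ)))
      = Real.exp (-(c * a j)) * Real.exp (-(c * a k)) * (1 + ∑ t ∈ Finset.range (2 * B),
          (g (t + 1) - g t) * ((if t < a j then 1 else 0) * (if t < a k then 1 else 0))) := by
    intro j k
    have h1 : ∑ t ∈ Finset.range (2 * B),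
          (g (t + 1) - g t) * ((if t < a j then (1 : ℝ) else 0) * (if t < a k then 1 else 0))
        = ∑ t ∈ Finset.range (min (a j) (a k)), (g (t + 1) - g t) := by
      have hsub : Finset.range (min (a j) (a k)) ⊆ Finset.range (2 * B) := by
        intro t ht
        rw [Finset.mem_range] at ht ⊢
        have := haz j; have := abs_le.1 (hB j)
        omega
      rw [← Finset.sum_subset hsub]
      · refine Finset.sum_congr rfl fun t ht => ?_
        rw [Finset.mem_range, lt_min_iff] at ht
        simp [ht.1, ht.2]
      · intro t _ ht
        rw [Finset.mem_range, lt_min_iff, not_and_or] at ht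
        rcases ht with h | h <;> simp [h]
    rw [h1, Finset.sum_range_sub, hg]
    simp only [Nat.cast_zero, mul_zero, Real.exp_zero, add_sub_cancel]
    rw [← Real.exp_add, ← Real.exp_add]
    congr 1
    have h2 : (|z j - z k| : ℤ) = a j + a k - 2 * (min (a j) (a k) : ℕ) := by
      have := haz j; have := haz k; (simp only [Int.abs_eq_natAbs] at *; omega)
    rw [h2]; push_cast; ring
  have hexp : ∑ i, ∑ j, x i * x j * Matrix.of (fun j k => Real.exp (-(c * ((|z j - z k| : ℤ) : ℝ)))) i j
      = (∑ i, x i * Real.exp (-(c * a i))) ^ 2 + ∑ t ∈ Finset.range (2 * B), (g (t + 1) - g t) *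
        (∑ i, x i * Real.exp (-(c * a i)) * (if t < a i then 1 else 0)) ^ 2 := by
    simp only [Matrix.of_apply, hker]
    simp_rw [sq, Finset.sum_mul_sum, Finset.mul_sum]
    rw [Finset.sum_comm (s := Finset.range (2 * B)), ← Finset.sum_add_distrib]
    refine Finset.sum_congr rfl fun i _ => ?_
    rw [Finset.sum_comm (s := Finset.range (2 * B)), ← Finset.sum_add_distrib]
    refine Finset.sum_congr rfl fun j _ => ?_
    rw [mul_add, mul_one, mul_add, Finset.mul_sum, Finset.mul_sum]
    congr 1
    · ring
    · exact Finset.sum_congr rfl fun t _ => by ring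
  rw [hexp]
  refine add_nonneg (sq_nonneg _) (Finset.sum_nonneg fun t _ => mul_nonneg ?_ (sq_nonneg _))
  rw [sub_nonneg]
  refine Real.exp_le_exp.2 ?_
  push_cast
  nlinarith

/-- For an axial norm `q` on the plane, `exp (-μ q)` is a positive semidefinite kernel on the
integer points. -/
theorem IsAxialNorm.posSemidef_exp_neg {q : ℝ → ℝ → ℝ} (hq : IsAxialNorm q) {μ : ℝ} (hμ : 0 ≤ μ)
    {ι : Type*} [Fintype ι] (x y : ι → ℤ) :
    (Matrix.of fun j k => Real.exp (-(μ * q ((x j - x k : ℤ)) ((y j - y k : ℤ))))).PosSemidef := by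
  obtain ⟨n, hx, hy⟩ : ∃ n : ℕ, (∀ j k, |x j - x k| ≤ n) ∧ ∀ j k, |y j - y k| ≤ n := by
    refine ⟨∑ p : ι × ι, ((x p.1 - x p.2).natAbs + (y p.1 - y p.2).natAbs), ?_⟩
    have key : ∀ j k, (x j - x k).natAbs + (y j - y k).natAbs ≤
        ∑ p : ι × ι, ((x p.1 - x p.2).natAbs + (y p.1 - y p.2).natAbs) := fun j k =>
      Finset.single_le_sum (f := fun p : ι × ι => (x p.1 - x p.2).natAbs + (y p.1 - y p.2).natAbs)
        (fun _ _ => Nat.zero_le _) (Finset.mem_univ (j, k))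
    exact ⟨fun j k => by have := key j k; (simp only [Int.abs_eq_natAbs] at *; omega), fun j k => by have := key j k; (simp only [Int.abs_eq_natAbs] at *; omega)⟩
  obtain ⟨I, w₀, w, M, hw₀, hw, hsum⟩ := hq.exists_sum_abs n
  -- The exponential turns the sum of absolute values into an entrywise product, so the Schur
  -- product theorem applies one linear form at a time.
  have hprod : ∀ J : Finset ℤ, J ⊆ I → (Matrix.of fun j k => Real.exp (-(μ *
      (w₀ * ((|y j - y k| : ℤ) : ℝ)
        + ∑ i ∈ J, w i * ((|(x j - x k) * M - (y j - y k) * i| : ℤ) : ℝ))))).PosSemidef := by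
    intro J
    induction J using Finset.induction_on with
    | empty =>
      intro _
      have := posSemidef_exp_abs (μ * w₀) (mul_nonneg hμ hw₀) y
      simpa [mul_assoc] using this
    | insert i J hi ih =>
      intro hJ
      rw [Finset.insert_subset_iff] at hJ
      have h1 := ih hJ.2
      have h2 := posSemidef_exp_abs (μ * w i) (mul_nonneg hμ (hw i hJ.1))
        (fun j => x j * M - y j * i)
      have h3 := h1.hadamard h2
      refine (congrArg Matrix.PosSemidef ?_).mpr h3
      ext j k
      simp only [Matrix.of_apply, Matrix.hadamard_apply]
      rw [← Real.exp_add, Finset.sum_insert hi]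
      congr 1
      have : x j * M - y j * i - (x k * M - y k * i) = (x j - x k) * M - (y j - y k) * i := by ring
      rw [this]; ring
  have := hprod I subset_rfl
  convert this using 5 with j k
  rw [hsum _ _ (hx j k) (hy j k)]

/-! ### Strict positivity of Fourier symbols on the torus -/

section Torus

open UnitAddTorus

variable {d : Type*} [Fintype d]

/-- The normalised Haar measure of the torus. -/
noncomputable def torusMeasure (d : Type*) [Fintype d] : Measure (UnitAddTorus d) :=
  Measure.pi fun _ => AddCircle.haarAddCircle

instance : IsProbabilityMeasure (torusMeasure d) := by
  unfold torusMeasure; infer_instance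

instance : Measure.IsAddHaarMeasure (torusMeasure d) := by
  unfold torusMeasure; infer_instance

theorem integrable_torus {E : Type*} [NormedAddCommGroup E] (g : C(UnitAddTorus d, E)) :
    Integrable g (torusMeasure d) :=
  g.continuous.integrable_of_hasCompactSupport (HasCompactSupport.of_compactSpace _)

/-- Integration over the torus as a continuous linear functional. -/
noncomputable def torusIntegral (d : Type*) [Fintype d] : C(UnitAddTorus d, ℂ) →L[ℂ] ℂ :=
  LinearMap.mkContinuous
    { toFun := fun g => ∫ t, g t ∂(torusMeasure d)
      map_add' := fun g h => integral_add (integrable_torus g) (integrable_torus h)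
      map_smul' := fun c g => integral_const_mul c _ } 1 fun g => by
    have := norm_integral_le_of_norm_le_const (μ := torusMeasure d) (f := g) (C := ‖g‖)
      (Eventually.of_forall fun t => g.norm_coe_le_norm t)
    simpa using this

theorem torusIntegral_apply (g : C(UnitAddTorus d, ℂ)) :
    torusIntegral d g = ∫ t, g t ∂(torusMeasure d) := rfl

/-- Translation invariance multiplies the integral by the value of the character at the shift. Half
a period in a coordinate with nonzero frequency gives the value -1. -/
theorem torusIntegral_mFourier [DecidableEq d] (n : d → ℤ) :
    torusIntegral d (mFourier n) = if n = 0 then 1 else 0 := by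
  rw [torusIntegral_apply]
  split_ifs with h
  · subst h; simp [mFourier_zero]
  · obtain ⟨s, hs⟩ : ∃ s : UnitAddTorus d, mFourier n s ≠ 1 := by
      obtain ⟨i, hi⟩ := Function.ne_iff.1 h
      refine ⟨Pi.single i (((1 / 2 / n i : ℝ)) : UnitAddCircle), ?_⟩
      have : mFourier n (Pi.single i (((1 / 2 / n i : ℝ)) : UnitAddCircle))
          = fourier (n i) (((1 / 2 / n i : ℝ)) : UnitAddCircle) := by
        simp only [mFourier, ContinuousMap.coe_mk]
        rw [Finset.prod_eq_single i]
        · simp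
        · intro j _ hj; simp [hj]
        · simp
      rw [this]
      have h2 := fourier_add_half_inv_index (T := (1 : ℝ)) hi one_pos 0
      rw [zero_add, fourier_eval_zero] at h2
      intro h3
      have h4 : (-1 : ℂ) = 1 := h2.symm.trans h3
      norm_num at h4
    have h1 : ∫ t, mFourier n (t + s) ∂(torusMeasure d) = ∫ t, mFourier n t ∂(torusMeasure d) :=
      integral_add_right_eq_self _ s
    have h2 : ∀ t, mFourier n (t + s) = mFourier n t * mFourier n s := by
      intro t
      simp only [mFourier, ContinuousMap.coe_mk, ← Finset.prod_mul_distrib]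
      refine Finset.prod_congr rfl fun i _ => ?_
      simp [fourier_apply, smul_add, AddCircle.toCircle_add]
    simp_rw [h2] at h1
    rw [integral_mul_const] at h1
    have h3 : (∫ t, mFourier n t ∂(torusMeasure d)) * (mFourier n s - 1) = 0 := by
      rw [mul_sub, h1]; ring
    exact (mul_eq_zero.1 h3).resolve_right (sub_ne_zero.2 hs)

theorem eq_zero_of_torus_integral_eq_zero {h : UnitAddTorus d → ℝ} (hc : Continuous h)
    (h0 : ∀ t, 0 ≤ h t) (hi : ∫ t, h t ∂(torusMeasure d) = 0) (t : UnitAddTorus d) : h t = 0 := by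
  have h1 := (integral_eq_zero_iff_of_nonneg (μ := torusMeasure d) (f := h) h0
    (integrable_torus ⟨h, hc⟩)).1 hi
  have h2 := (Continuous.ae_eq_iff_eq (torusMeasure d) hc continuous_const).1 h1
  exact congrFun h2 t

theorem norm_mFourier_apply_le (k : d → ℤ) (t : UnitAddTorus d) : ‖mFourier k t‖ ≤ 1 :=
  ((mFourier k).norm_coe_le_norm t).trans_eq mFourier_norm

/-- A length function on a lattice all of whose exponentials are summable positive definite
kernels. -/
structure IsNegDefLength (ψ : (d → ℤ) → ℝ) : Prop where
  zero : ψ 0 = 0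
  pos : ∀ k, k ≠ 0 → 0 < ψ k
  neg : ∀ k, ψ (-k) = ψ k
  summable : ∀ μ, 0 < μ → Summable fun k => Real.exp (-(μ * ψ k))
  posSemidef : ∀ μ, 0 < μ → ∀ (S : Finset (d → ℤ)) (x : (d → ℤ) → ℝ),
    0 ≤ ∑ i ∈ S, ∑ j ∈ S, x i * x j * Real.exp (-(μ * ψ (i - j)))

/-- The Fourier series with coefficients `exp (-μ ψ k)`. -/
noncomputable def symb (ψ : (d → ℤ) → ℝ) (μ : ℝ) : C(UnitAddTorus d, ℂ) :=
  ∑' k, (Real.exp (-(μ * ψ k)) : ℂ) • mFourier k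

variable {ψ : (d → ℤ) → ℝ} {μ : ℝ}

theorem IsNegDefLength.hasSum_symb (hψ : IsNegDefLength ψ) (hμ : 0 < μ) :
    HasSum (fun k => (Real.exp (-(μ * ψ k)) : ℂ) • mFourier k) (symb ψ μ) := by
  refine Summable.hasSum (Summable.of_norm ?_)
  refine (hψ.summable μ hμ).congr fun k => ?_
  rw [norm_smul, mFourier_norm, mul_one, Complex.norm_real, Real.norm_of_nonneg (Real.exp_pos _).le]

theorem IsNegDefLength.hasSum_symb_apply (hψ : IsNegDefLength ψ) (hμ : 0 < μ) (t : UnitAddTorus d) :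
    HasSum (fun k => (Real.exp (-(μ * ψ k)) : ℂ) * mFourier k t) (symb ψ μ t) :=
  (ContinuousMap.evalCLM ℂ t).hasSum (hψ.hasSum_symb hμ)

theorem IsNegDefLength.symb_real (hψ : IsNegDefLength ψ) (hμ : 0 < μ) (t : UnitAddTorus d) :
    symb ψ μ t = ((symb ψ μ t).re : ℂ) := by
  have h1 := hψ.hasSum_symb_apply hμ t
  have h2 := Complex.hasSum_conj'.2 h1
  have h3 := (Equiv.neg (d → ℤ)).hasSum_iff.2 h1
  refine (Complex.conj_eq_iff_re.1 ?_).symm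
  refine h2.unique ?_
  convert h3 using 1
  ext k
  simp only [Function.comp_apply, Equiv.neg_apply, map_mul, Complex.conj_ofReal, hψ.neg, mFourier_neg]

theorem IsNegDefLength.torusIntegral_symb_mul_mFourier (hψ : IsNegDefLength ψ) (hμ : 0 < μ) [DecidableEq d] (n : d → ℤ) :
    torusIntegral d (symb ψ μ * mFourier n) = Real.exp (-(μ * ψ n)) := by
  have h1 := (torusIntegral d).hasSum ((hψ.hasSum_symb hμ).mul_right (mFourier n))
  refine h1.unique ?_
  have : ∀ k, torusIntegral d ((Real.exp (-(μ * ψ k)) : ℂ) • mFourier k * mFourier n)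
      = if k = -n then (Real.exp (-(μ * ψ n)) : ℂ) else 0 := by
    intro k
    have h2 : mFourier k * mFourier n = mFourier (k + n) := by
      ext t; simp [mFourier_add]
    rw [smul_mul_assoc, h2, map_smul, torusIntegral_mFourier, smul_eq_mul]
    by_cases hk : k = -n
    · simp [hk, hψ.neg]
    · have : ¬ k + n = 0 := fun h => hk (eq_neg_of_add_eq_zero_left h)
      simp [hk, this]
  simp only [this]
  exact hasSum_ite_eq (-n) _

/-- Orthogonality of characters turns the Toeplitz form of the kernel into the integral of |P|²
against the symbol, the bridge between matrix bounds and pointwise bounds. -/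
theorem IsNegDefLength.torusIntegral_star_mul_self (hψ : IsNegDefLength ψ) (hμ : 0 < μ) [DecidableEq d] (S : Finset (d → ℤ)) (x : (d → ℤ) → ℂ) :
    torusIntegral d (star (∑ i ∈ S, x i • mFourier i) * (∑ i ∈ S, x i • mFourier i) * symb ψ μ)
      = ∑ i ∈ S, ∑ j ∈ S, star (x i) * x j * Real.exp (-(μ * ψ (i - j))) := by
  rw [star_sum, Finset.sum_mul_sum, Finset.sum_mul, map_sum]
  refine Finset.sum_congr rfl fun i _ => ?_
  rw [Finset.sum_mul, map_sum]
  refine Finset.sum_congr rfl fun j _ => ?_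
  have : star (x i • mFourier i) * (x j • mFourier j) * symb ψ μ
      = (star (x i) * x j) • (symb ψ μ * mFourier (j - i)) := by
    ext t
    simp [sub_eq_add_neg, mFourier_add, mFourier_neg]
    ring
  rw [this, map_smul, hψ.torusIntegral_symb_mul_mFourier hμ, smul_eq_mul, ← hψ.neg, neg_sub]

/-- The condition is closed in g and holds for trigonometric polynomials, which are dense. The real
part of a complex quadratic form splits into the forms of the real and imaginary parts of the
coefficients. -/
theorem IsNegDefLength.re_torusIntegral_nonneg (hψ : IsNegDefLength ψ) (hμ : 0 < μ) (g : C(UnitAddTorus d, ℂ)) :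
    0 ≤ (torusIntegral d (star g * g * symb ψ μ)).re := by
  classical
  have hclosed : IsClosed {g : C(UnitAddTorus d, ℂ) |
      0 ≤ (torusIntegral d (star g * g * symb ψ μ)).re} := by
    refine isClosed_le continuous_const ?_
    refine Complex.continuous_re.comp ((torusIntegral d).continuous.comp ?_)
    exact (continuous_star.mul continuous_id).mul continuous_const
  have hsub : (Submodule.span ℂ (Set.range (mFourier (d := d))) : Set C(UnitAddTorus d, ℂ)) ⊆
      {g | 0 ≤ (torusIntegral d (star g * g * symb ψ μ)).re} := by
    intro p hp
    rw [SetLike.mem_coe, Finsupp.mem_span_range_iff_exists_finsupp] at hp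
    obtain ⟨c, rfl⟩ := hp
    rw [Set.mem_ofPred_eq, Finsupp.sum, hψ.torusIntegral_star_mul_self hμ]
    have h1 := hψ.posSemidef μ hμ c.support fun k => (c k).re
    have h2 := hψ.posSemidef μ hμ c.support fun k => (c k).im
    refine (add_nonneg h1 h2).trans_eq ?_
    rw [Complex.re_sum, ← Finset.sum_add_distrib]
    refine Finset.sum_congr rfl fun i _ => ?_
    rw [Complex.re_sum, ← Finset.sum_add_distrib]
    refine Finset.sum_congr rfl fun j _ => ?_
    rw [Complex.re_mul_ofReal]
    simp
    ring
  have hcl := closure_minimal hsub hclosed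
  have htop := span_mFourier_closure_eq_top (d := d)
  have : g ∈ (Submodule.span ℂ (Set.range (mFourier (d := d)))).topologicalClosure := by
    rw [htop]; trivial
  exact hcl this

/-- Testing with the square root of the negative part yields minus the integral of that part
squared, so the negative part vanishes. -/
theorem IsNegDefLength.symb_nonneg (hψ : IsNegDefLength ψ) (hμ : 0 < μ) (t : UnitAddTorus d) : 0 ≤ (symb ψ μ t).re := by
  set f : UnitAddTorus d → ℝ := fun t => (symb ψ μ t).re with hf
  have hfc : Continuous f := Complex.continuous_re.comp (symb ψ μ).continuous
  set g : C(UnitAddTorus d, ℂ) := ⟨fun t => (Real.sqrt (max (-f t) 0) : ℂ), by fun_prop⟩ with hg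
  have h1 := hψ.re_torusIntegral_nonneg hμ g
  have h2 : torusIntegral d (star g * g * symb ψ μ)
      = ((-∫ t, (max (-f t) 0) ^ 2 ∂(torusMeasure d) : ℝ) : ℂ) := by
    rw [torusIntegral_apply, ← integral_neg, ← integral_complex_ofReal]
    congr 1
    ext t
    rw [ContinuousMap.mul_apply, ContinuousMap.mul_apply, hψ.symb_real hμ]
    simp only [hg, ContinuousMap.star_apply, ContinuousMap.coe_mk, Complex.star_def,
      Complex.conj_ofReal]
    rw [← Complex.ofReal_mul, Real.mul_self_sqrt (le_max_right _ _), ← Complex.ofReal_mul]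
    congr 1
    change max (-f t) 0 * f t = _
    rcases le_total (f t) 0 with h | h
    · rw [max_eq_left (by linarith)]; ring
    · rw [max_eq_right (by linarith)]; simp
  rw [h2, Complex.ofReal_re] at h1
  have h3 : ∫ t, (max (-f t) 0) ^ 2 ∂(torusMeasure d) = 0 :=
    le_antisymm (by linarith) (integral_nonneg fun t => sq_nonneg _)
  have h4 := eq_zero_of_torus_integral_eq_zero (by fun_prop) (fun t => sq_nonneg _) h3 t
  have h5 : max (-f t) 0 = 0 := by simpa using h4
  have := le_max_left (-f t) 0
  change 0 ≤ f t
  linarith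

/-- Coefficients multiply under convolution, and exp(-μψ) exp(-νψ) = exp(-(μ + ν)ψ). -/
theorem IsNegDefLength.symb_add (hψ : IsNegDefLength ψ) (hμ : 0 < μ) [DecidableEq d] {ν : ℝ} (hν : 0 < ν) (t₀ : UnitAddTorus d) :
    symb ψ (μ + ν) t₀ = ∫ t, symb ψ μ t * symb ψ ν (t₀ - t) ∂(torusMeasure d) := by
  set refl : C(UnitAddTorus d, UnitAddTorus d) := ⟨fun t => t₀ - t, by fun_prop⟩ with hrefl
  have h0 := (hψ.hasSum_symb hν).map (ContinuousMap.compRightAlgHom ℂ ℂ refl)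
    (ContinuousMap.compRightAlgHom_continuous ℂ ℂ refl)
  have h1 := (torusIntegral d).hasSum (h0.mul_left (symb ψ μ))
  have h2 : ∀ k, torusIntegral d (symb ψ μ * ContinuousMap.compRightAlgHom ℂ ℂ refl
      ((Real.exp (-(ν * ψ k)) : ℂ) • mFourier k))
      = (Real.exp (-((μ + ν) * ψ k)) : ℂ) * mFourier k t₀ := by
    intro k
    have h3 : symb ψ μ * ContinuousMap.compRightAlgHom ℂ ℂ refl
      ((Real.exp (-(ν * ψ k)) : ℂ) • mFourier k)
      = ((Real.exp (-(ν * ψ k)) : ℂ) * mFourier k t₀) • (symb ψ μ * mFourier (-k)) := by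
      ext t
      have : mFourier k (t₀ - t) = mFourier k t₀ * mFourier (-k) t := by
        simp only [mFourier, ContinuousMap.coe_mk, ← Finset.prod_mul_distrib]
        refine Finset.prod_congr rfl fun i _ => ?_
        simp [fourier_apply, sub_eq_add_neg, AddCircle.toCircle_add]
      simp only [ContinuousMap.mul_apply, ContinuousMap.smul_apply,
        ContinuousMap.compRightAlgHom_apply, ContinuousMap.comp_apply, hrefl,
        ContinuousMap.coe_mk, this, smul_eq_mul]
      ring
    rw [h3, map_smul, hψ.torusIntegral_symb_mul_mFourier hμ, smul_eq_mul, hψ.neg, add_mul, neg_add,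
      Real.exp_add]
    push_cast
    ring
  have h4 := hψ.hasSum_symb_apply (add_pos hμ hν) t₀
  refine h4.unique ?_
  refine (h1.congr_fun fun k => ?_)
  exact (h2 k).symm

theorem IsNegDefLength.symb_zero_pos (hψ : IsNegDefLength ψ) (hμ : 0 < μ) :
    0 < (symb ψ μ 0).re := by
  have h1 := Complex.hasSum_re (hψ.hasSum_symb_apply hμ 0)
  have h2 : ∀ k : d → ℤ, mFourier k (0 : UnitAddTorus d) = 1 := by
    intro k; simp [mFourier]
  simp only [h2, mul_one, Complex.ofReal_re] at h1
  have h3 := h1.summable.tsum_pos (fun k => (Real.exp_pos _).le) 0 (Real.exp_pos _)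
  rwa [h1.tsum_eq] at h3

/-- The convolution integrand is continuous and nonnegative, so a zero integral kills it everywhere.
At t = t₀ the second factor is the symbol at the origin, a sum of positive terms. -/
theorem IsNegDefLength.symb_eq_zero_of_add (hψ : IsNegDefLength ψ) (hμ : 0 < μ) {ν : ℝ}
    (hν : 0 < ν) {t₀ : UnitAddTorus d} (h : symb ψ (μ + ν) t₀ = 0) : symb ψ μ t₀ = 0 := by
  classical
  rw [hψ.symb_add hμ hν] at h
  have h1 : ∀ t, symb ψ μ t * symb ψ ν (t₀ - t)
      = (((symb ψ μ t).re * (symb ψ ν (t₀ - t)).re : ℝ) : ℂ) := by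
    intro t
    rw [hψ.symb_real hμ t, hψ.symb_real hν (t₀ - t)]
    simp
  simp_rw [h1] at h
  rw [integral_complex_ofReal, Complex.ofReal_eq_zero] at h
  have h2 := eq_zero_of_torus_integral_eq_zero
    (h := fun t => (symb ψ μ t).re * (symb ψ ν (t₀ - t)).re) (by fun_prop)
    (fun t => mul_nonneg (hψ.symb_nonneg hμ t) (hψ.symb_nonneg hν _)) h t₀
  simp only [sub_self] at h2
  rw [hψ.symb_real hμ, (mul_eq_zero.1 h2).resolve_right (hψ.symb_zero_pos hν).ne',
    Complex.ofReal_zero]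

theorem IsNegDefLength.nonneg (hψ : IsNegDefLength ψ) (k : d → ℤ) : 0 ≤ ψ k := by
  by_cases h : k = 0
  · rw [h, hψ.zero]
  · exact (hψ.pos k h).le

/-- The symbol at a fixed frequency extends analytically in the parameter to a half plane. -/
theorem IsNegDefLength.analyticOnNhd (hψ : IsNegDefLength ψ) (t : UnitAddTorus d) :
    AnalyticOnNhd ℂ (fun z : ℂ => ∑' k, Complex.exp (-(z * ψ k)) * mFourier k t)
      {z | 0 < z.re} := by
  have hopen : IsOpen {z : ℂ | 0 < z.re} := isOpen_lt continuous_const Complex.continuous_re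
  refine DifferentiableOn.analyticOnNhd (fun z hz => ?_) hopen
  have hz' : 0 < z.re := hz
  -- On this smaller half plane the series is dominated by the summable exponentials with parameter
  -- Re z / 2, which permits termwise differentiation.
  have hopen2 : IsOpen {w : ℂ | z.re / 2 < w.re} := isOpen_lt continuous_const Complex.continuous_re
  have h1 : DifferentiableOn ℂ (fun z : ℂ => ∑' k, Complex.exp (-(z * ψ k)) * mFourier k t)
      {w : ℂ | z.re / 2 < w.re} := by
    refine Complex.differentiableOn_tsum_of_summable_norm (hψ.summable (z.re / 2) (by linarith)) ?_
      hopen2 ?_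
    · intro k; fun_prop
    · intro k w hw
      have hw' : z.re / 2 < w.re := hw
      have h2 : ‖mFourier k t‖ ≤ 1 := norm_mFourier_apply_le k t
      rw [norm_mul, Complex.norm_exp]
      have h3 : (-(w * ψ k)).re ≤ -(z.re / 2 * ψ k) := by
        rw [Complex.neg_re, Complex.re_mul_ofReal]
        nlinarith [hψ.nonneg k]
      calc _ ≤ Real.exp (-(z.re / 2 * ψ k)) * 1 :=
            mul_le_mul (Real.exp_le_exp.2 h3) h2 (norm_nonneg _) (Real.exp_pos _).le
        _ = _ := mul_one _
  exact (h1.differentiableAt (hopen2.mem_nhds (show z.re / 2 < z.re by linarith))).differentiableWithinAt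

theorem IsNegDefLength.symb_eq_tsum (hψ : IsNegDefLength ψ) (hμ : 0 < μ) (t : UnitAddTorus d) :
    symb ψ μ t = ∑' k, Complex.exp (-((μ : ℂ) * ψ k)) * mFourier k t := by
  rw [← (hψ.hasSum_symb_apply hμ t).tsum_eq]
  push_cast
  rfl

/-- Only the frequency zero survives, by dominated convergence with the parameter 1 series. -/
theorem IsNegDefLength.tendsto_symb (hψ : IsNegDefLength ψ) (t : UnitAddTorus d) :
    Tendsto (fun ν : ℝ => symb ψ ν t) atTop (𝓝 1) := by
  classical
  have h1 : Tendsto (fun ν : ℝ => ∑' k, (Real.exp (-(ν * ψ k)) : ℂ) * mFourier k t) atTop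
      (𝓝 (∑' k : d → ℤ, if k = 0 then 1 else 0)) := by
    refine tendsto_tsum_of_dominated_convergence (hψ.summable 1 one_pos) ?_ ?_
    · intro k
      by_cases hk : k = 0
      · subst hk
        simp [hψ.zero, mFourier_zero]
      · simp only [hk, if_false]
        have h2 : Tendsto (fun ν : ℝ => Real.exp (-(ν * ψ k))) atTop (𝓝 0) :=
          Real.tendsto_exp_neg_atTop_nhds_zero.comp (tendsto_id.atTop_mul_const (hψ.pos k hk))
        have h3 := (Complex.continuous_ofReal.tendsto 0).comp h2
        simpa using h3.mul_const (mFourier k t)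
    · filter_upwards [eventually_ge_atTop (1 : ℝ)] with ν hν k
      have h2 : ‖mFourier k t‖ ≤ 1 := norm_mFourier_apply_le k t
      rw [norm_mul, Complex.norm_real, Real.norm_of_nonneg (Real.exp_pos _).le]
      calc _ ≤ Real.exp (-(1 * ψ k)) * 1 :=
            mul_le_mul (Real.exp_le_exp.2 (by nlinarith [hψ.nonneg k])) h2 (norm_nonneg _)
              (Real.exp_pos _).le
        _ = _ := mul_one _
  rw [tsum_ite_eq] at h1
  refine h1.congr' ?_
  filter_upwards [eventually_gt_atTop (0 : ℝ)] with ν hν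
  exact (hψ.hasSum_symb_apply hν t).tsum_eq

/-- A zero at μ spreads to (0, μ) by the semigroup law and to the whole half plane by the identity
theorem. The symbol at t would then vanish for all parameters, although it tends to 1. -/
theorem IsNegDefLength.symb_pos (hψ : IsNegDefLength ψ) (hμ : 0 < μ) (t : UnitAddTorus d) :
    0 < (symb ψ μ t).re := by
  refine (hψ.symb_nonneg hμ t).lt_of_ne' fun h0 => ?_
  have h1 : symb ψ μ t = 0 := by rw [hψ.symb_real hμ, h0, Complex.ofReal_zero]
  have h2 : ∀ ν, 0 < ν → ν < μ → symb ψ ν t = 0 := fun ν hν hνμ =>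
    hψ.symb_eq_zero_of_add hν (sub_pos.2 hνμ) (by rwa [add_sub_cancel])
  have hfreq : ∃ᶠ z in 𝓝[≠] ((μ / 2 : ℝ) : ℂ),
      (fun z : ℂ => ∑' k, Complex.exp (-(z * ψ k)) * mFourier k t) z = 0 := by
    -- These parameters lie in [μ/4, μ/2) and accumulate at μ/2, inside the interval of known zeros.
    have hseq : Tendsto (fun n : ℕ => ((μ / 2 - μ / 4 * (1 / ((n : ℝ) + 1)) : ℝ) : ℂ)) atTop
        (𝓝[≠] ((μ / 2 : ℝ) : ℂ)) := by
      refine tendsto_nhdsWithin_iff.2 ⟨?_, Eventually.of_forall fun n => ?_⟩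
      · refine (Complex.continuous_ofReal.tendsto _).comp ?_
        have := (tendsto_one_div_add_atTop_nhds_zero_nat (𝕜 := ℝ)).const_mul (μ / 4)
        simpa using this.const_sub (μ / 2)
      · have : 0 < μ / 4 * (1 / ((n : ℝ) + 1)) := by positivity
        rw [Set.mem_compl_singleton_iff, Ne, Complex.ofReal_inj]
        linarith
    refine hseq.frequently (Frequently.of_forall fun n => ?_)
    have h3 : 0 < μ / 4 * (1 / ((n : ℝ) + 1)) := by positivity
    have h4 : 1 / ((n : ℝ) + 1) ≤ 1 := by
      rw [div_le_one (by positivity)]; linarith [(Nat.cast_nonneg n : (0 : ℝ) ≤ n)]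
    have h5 : μ / 4 * (1 / ((n : ℝ) + 1)) ≤ μ / 4 * 1 :=
      mul_le_mul_of_nonneg_left h4 (by positivity)
    have h6 : 0 < μ / 2 - μ / 4 * (1 / ((n : ℝ) + 1)) := by linarith
    refine (hψ.symb_eq_tsum h6 t).symm.trans ?_
    exact h2 _ (by linarith) (by linarith)
  have h3 := (hψ.analyticOnNhd t).eqOn_zero_of_preconnected_of_frequently_eq_zero
    (convex_halfSpace_re_gt 0).isPreconnected (show 0 < ((μ / 2 : ℝ) : ℂ).re by simpa using hμ) hfreq
  have h4 : Tendsto (fun ν : ℝ => symb ψ ν t) atTop (𝓝 0) := by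
    refine tendsto_const_nhds.congr' ?_
    filter_upwards [eventually_gt_atTop (0 : ℝ)] with ν hν
    rw [hψ.symb_eq_tsum hν]
    exact (h3 (show 0 < (ν : ℂ).re by simpa using hν)).symm
  exact zero_ne_one (tendsto_nhds_unique h4 (hψ.tendsto_symb t))

/-- The exponential kernel of a negative definite length dominates a multiple of the identity. -/
theorem IsNegDefLength.exists_lower_bound (hψ : IsNegDefLength ψ) (hμ : 0 < μ) :
    ∃ δ : ℝ, 0 < δ ∧ ∀ (S : Finset (d → ℤ)) (x : (d → ℤ) → ℝ),
      δ * ∑ i ∈ S, x i ^ 2 ≤ ∑ i ∈ S, ∑ j ∈ S, x i * x j * Real.exp (-(μ * ψ (i - j))) := by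
  classical
  have hc : Continuous fun t => (symb ψ μ t).re := by fun_prop
  -- The constant δ is the minimum of the symbol; Parseval converts this pointwise bound into one
  -- for the quadratic form, independently of S.
  obtain ⟨t₀, -, ht₀⟩ := isCompact_univ.exists_isMinOn Set.univ_nonempty hc.continuousOn
  refine ⟨(symb ψ μ t₀).re, hψ.symb_pos hμ t₀, fun S x => ?_⟩
  set P : C(UnitAddTorus d, ℂ) := ∑ i ∈ S, (x i : ℂ) • mFourier i with hP
  have h1 : torusIntegral d (star P * P * symb ψ μ)
      = ∑ i ∈ S, ∑ j ∈ S, star (x i : ℂ) * x j * Real.exp (-(μ * ψ (i - j))) :=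
    hψ.torusIntegral_star_mul_self hμ S fun i => (x i : ℂ)
  have h2 : torusIntegral d (star P * P) = ∑ i ∈ S, (x i : ℂ) ^ 2 := by
    rw [hP, star_sum, Finset.sum_mul_sum, map_sum]
    refine Finset.sum_congr rfl fun i hi => ?_
    rw [map_sum]
    have h3 : ∀ j, torusIntegral d (star ((x i : ℂ) • mFourier i) * ((x j : ℂ) • mFourier j))
        = if j = i then (x i : ℂ) ^ 2 else 0 := by
      intro j
      have : star ((x i : ℂ) • mFourier i) * ((x j : ℂ) • mFourier j)
          = ((x i : ℂ) * x j) • mFourier (j - i) := by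
        ext t
        simp [sub_eq_add_neg, mFourier_add, mFourier_neg]
        ring
      rw [this, map_smul, torusIntegral_mFourier, smul_eq_mul]
      by_cases hj : j = i
      · simp [hj, sq]
      · simp [hj, sub_eq_zero]
    rw [Finset.sum_congr rfl fun j _ => h3 j, Finset.sum_ite_eq', if_pos hi]
  have hn : ∀ t, (star P * P) t = ((Complex.normSq (P t) : ℝ) : ℂ) := by
    intro t
    rw [ContinuousMap.mul_apply, ContinuousMap.star_apply, Complex.star_def,
      Complex.normSq_eq_conj_mul_self]
  rw [torusIntegral_apply] at h1 h2
  have e1 : ∀ t, (star P * P * symb ψ μ) t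
      = ((Complex.normSq (P t) * (symb ψ μ t).re : ℝ) : ℂ) := by
    intro t
    rw [ContinuousMap.mul_apply, hn, Complex.ofReal_mul, ← hψ.symb_real hμ]
  simp_rw [e1] at h1
  simp only [hn] at h2
  rw [integral_complex_ofReal] at h1 h2
  have h1' : ∫ t, Complex.normSq (P t) * (symb ψ μ t).re ∂(torusMeasure d)
      = ∑ i ∈ S, ∑ j ∈ S, x i * x j * Real.exp (-(μ * ψ (i - j))) := by
    have := congrArg Complex.re h1
    rw [Complex.ofReal_re] at this
    rw [this, Complex.re_sum]
    refine Finset.sum_congr rfl fun i _ => ?_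
    rw [Complex.re_sum]
    refine Finset.sum_congr rfl fun j _ => ?_
    rw [Complex.star_def, Complex.conj_ofReal, ← Complex.ofReal_mul, ← Complex.ofReal_mul,
      Complex.ofReal_re]
  have h2' : ∫ t, Complex.normSq (P t) ∂(torusMeasure d) = ∑ i ∈ S, x i ^ 2 := by
    exact_mod_cast h2
  rw [← h1', ← h2', ← integral_const_mul]
  have hcn : Continuous fun t => Complex.normSq (P t) :=
    Complex.continuous_normSq.comp P.continuous
  refine integral_mono (integrable_torus ⟨_, continuous_const.mul hcn⟩)
    (integrable_torus ⟨_, hcn.mul hc⟩) fun t => ?_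
  have := isMinOn_iff.1 ht₀ t (Set.mem_univ t)
  rw [mul_comm]
  exact mul_le_mul_of_nonneg_left this (Complex.normSq_nonneg _)

end Torus
-- The L_p lattice and uniform bounds for the correlation matrices
/-- The `L_p` norm on the plane. -/
noncomputable def lpNormPlane (p x y : ℝ) : ℝ := (|x| ^ p + |y| ^ p) ^ (1 / p)

theorem isAxialNorm_lpNormPlane {p : ℝ} (hp : 1 ≤ p) : IsAxialNorm (lpNormPlane p) where
  add_le x y x' y' := by
    have := Real.Lp_add_le (Finset.univ : Finset (Fin 2)) ![x, y] ![x', y'] hp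
    simpa [lpNormPlane] using this
  smul c x y := by
    have hp0 : p ≠ 0 := by linarith
    unfold lpNormPlane
    rw [abs_mul, abs_mul, Real.mul_rpow (abs_nonneg _) (abs_nonneg _),
      Real.mul_rpow (abs_nonneg _) (abs_nonneg _), ← mul_add,
      Real.mul_rpow (by positivity) (by positivity), ← Real.rpow_mul (abs_nonneg _),
      mul_one_div_cancel hp0, Real.rpow_one]
  axis x := by
    have hp0 : p ≠ 0 := by linarith
    unfold lpNormPlane
    rw [abs_zero, Real.zero_rpow hp0, add_zero, ← Real.rpow_mul (abs_nonneg _),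
      mul_one_div_cancel hp0, Real.rpow_one]
  neg_fst x y := by simp [lpNormPlane]

theorem abs_fst_le_lpNormPlane {p : ℝ} (hp : 1 ≤ p) (x y : ℝ) : |x| ≤ lpNormPlane p x y := by
  have hp0 : p ≠ 0 := by linarith
  calc |x| = (|x| ^ p) ^ (1 / p) := by
        rw [← Real.rpow_mul (abs_nonneg _), mul_one_div_cancel hp0, Real.rpow_one]
    _ ≤ _ := Real.rpow_le_rpow (by positivity)
        (le_add_of_nonneg_right (by positivity)) (by positivity)

theorem lpNormPlane_comm (p x y : ℝ) : lpNormPlane p x y = lpNormPlane p y x := by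
  unfold lpNormPlane; rw [add_comm]

/-- The `L_p` norm on the square lattice. -/
noncomputable def lpLattice (p : ℝ) (k : Fin 2 → ℤ) : ℝ := lpNormPlane p (k 0) (k 1)

/-- Averaging the two coordinate bounds gives an additive minorant, so the lattice exponential is
dominated by a product of two one-dimensional summable ones. -/
theorem half_sum_abs_le_lpLattice {p : ℝ} (hp : 1 ≤ p) (k : Fin 2 → ℤ) :
    (|(k 0 : ℝ)| + |(k 1 : ℝ)|) / 2 ≤ lpLattice p k := by
  have h1 := abs_fst_le_lpNormPlane hp (k 0) (k 1)
  have h2 := abs_fst_le_lpNormPlane hp (k 1) (k 0)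
  rw [lpNormPlane_comm] at h2
  unfold lpLattice
  linarith

theorem summable_exp_neg_abs_int {c : ℝ} (hc : 0 < c) :
    Summable fun k : ℤ => Real.exp (-(c * |(k : ℝ)|)) := by
  have h : Summable fun k : ℕ => Real.exp (-(c * (k : ℝ))) := by
    have := Real.summable_exp_nat_mul_iff (a := -c)
    refine (this.2 (by linarith)).congr fun k => ?_
    congr 1; ring
  refine Summable.of_nat_of_neg ?_ ?_
  · simpa using h
  · simpa using h

theorem isNegDefLength_lpLattice {p : ℝ} (hp : 1 ≤ p) : IsNegDefLength (lpLattice p) where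
  zero := by
    unfold lpLattice
    simpa using (isAxialNorm_lpNormPlane hp).axis 0
  pos k hk := by
    refine lt_of_lt_of_le ?_ (half_sum_abs_le_lpLattice hp k)
    obtain ⟨i, hi⟩ := Function.ne_iff.1 hk
    fin_cases i
    · have : 0 < |(k 0 : ℝ)| := abs_pos.2 (by exact_mod_cast hi)
      positivity
    · have : 0 < |(k 1 : ℝ)| := abs_pos.2 (by exact_mod_cast hi)
      positivity
  neg k := by simp [lpLattice, lpNormPlane]
  summable μ hμ := by
    have h1 := summable_exp_neg_abs_int (show 0 < μ / 2 by linarith)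
    have h2 := h1.mul_of_nonneg h1 (fun _ => (Real.exp_pos _).le) (fun _ => (Real.exp_pos _).le)
    have h3 := (finTwoArrowEquiv ℤ).summable_iff.2 h2
    refine Summable.of_nonneg_of_le (fun _ => (Real.exp_pos _).le) (fun k => ?_) h3
    simp only [Function.comp, finTwoArrowEquiv_apply]
    rw [← Real.exp_add]
    refine Real.exp_le_exp.2 ?_
    have := mul_le_mul_of_nonneg_left (half_sum_abs_le_lpLattice hp k) hμ.le
    change -(μ / 2 * |(k 0 : ℝ)|) + -(μ / 2 * |(k 1 : ℝ)|) ≥ _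
    linarith
  posSemidef μ hμ S x := by
    have h := (isAxialNorm_lpNormPlane hp).posSemidef_exp_neg hμ.le
      (fun k : S => (k : Fin 2 → ℤ) 0) (fun k : S => (k : Fin 2 → ℤ) 1)
    have h2 := PosSemidef.sum_nonneg h fun k : S => x k
    rw [← Finset.sum_coe_sort]
    simp_rw [← Finset.sum_coe_sort S (fun j => x _ * x j * _)]
    exact h2

/-- The coordinates of a site as a lattice point. -/
def siteEmb (m n : ℕ) : Site m n ↪ (Fin 2 → ℤ) where
  toFun s := ![((s.1 : ℕ) : ℤ), ((s.2 : ℕ) : ℤ)]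
  inj' s s' h := by
    have h0 := congrFun h 0
    have h1 := congrFun h 1
    simp only [Matrix.cons_val_zero, Matrix.cons_val_one, Nat.cast_inj] at h0 h1
    exact Prod.ext (Fin.ext h0) (Fin.ext h1)

theorem lpDist_eq_lpLattice (p : ℝ) {m n : ℕ} (s s' : Site m n) :
    lpDist p s s' = lpLattice p (siteEmb m n s - siteEmb m n s') := by
  have h0 : ∀ s : Site m n, siteEmb m n s 0 = ((s.1 : ℕ) : ℤ) := fun _ => rfl
  have h1 : ∀ s : Site m n, siteEmb m n s 1 = ((s.2 : ℕ) : ℤ) := fun _ => rfl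
  simp [lpDist, lpLattice, lpNormPlane, h0, h1]

theorem lpDist_pos {p : ℝ} (hp : 1 ≤ p) {m n : ℕ} {s s' : Site m n} (h : s ≠ s') :
    0 < lpDist p s s' := by
  rw [lpDist_eq_lpLattice]
  exact (isNegDefLength_lpLattice hp).pos _ (sub_ne_zero.2 ((siteEmb m n).injective.ne h))

theorem lpDist_comm (p : ℝ) {m n : ℕ} (s s' : Site m n) : lpDist p s s' = lpDist p s' s := by
  unfold lpDist
  rw [abs_sub_comm, abs_sub_comm ((s.2 : ℕ) : ℝ)]

theorem corrMatrix_comm (a ρ p : ℝ) {m n : ℕ} (s s' : Site m n) :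
    corrMatrix a ρ p m n s s' = corrMatrix a ρ p m n s' s := by
  simp only [corrMatrix, Matrix.of_apply, eq_comm, lpDist_comm p s s']

theorem corrMatrix_zero {a p : ℝ} (hp : 1 ≤ p) (m n : ℕ) : corrMatrix a 0 p m n = 1 := by
  ext s s'
  by_cases h : s = s'
  · subst h; simp [corrMatrix]
  · simp [corrMatrix, h, Real.zero_rpow (lpDist_pos hp h).ne']

/-- The decomposition is Γ = aE + (1 - a)I with E the exponential kernel of rate -log ρ. It needs ρ
> 0; the case ρ = 0 is the identity matrix. -/
theorem corrMatrix_apply_of_pos {a ρ p : ℝ} (hρ : 0 < ρ) (hp : 1 ≤ p) {m n : ℕ} (s s' : Site m n) :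
    corrMatrix a ρ p m n s s' = a * Real.exp (-(-Real.log ρ *
      lpLattice p (siteEmb m n s - siteEmb m n s'))) + if s = s' then 1 - a else 0 := by
  by_cases h : s = s'
  · subst h
    simp [corrMatrix, (isNegDefLength_lpLattice hp).zero]
  · simp [corrMatrix, h, lpDist_eq_lpLattice, Real.rpow_def_of_pos hρ]

theorem corrMatrix_nonneg {a ρ p : ℝ} (ha : 0 ≤ a) (hρ : 0 ≤ ρ) {m n : ℕ} (s s' : Site m n) :
    0 ≤ corrMatrix a ρ p m n s s' := by
  simp only [corrMatrix, Matrix.of_apply]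
  split_ifs
  · exact zero_le_one
  · positivity

/-- The correlation matrices are bounded below, uniformly in the grid. -/
theorem exists_corrMatrix_lower_bound {a ρ p : ℝ} (ha0 : 0 < a) (ha1 : a ≤ 1) (hρ0 : 0 ≤ ρ)
    (hρ1 : ρ < 1) (hp : 1 ≤ p) :
    ∃ δ : ℝ, 0 < δ ∧ ∀ (m n : ℕ) (x : Site m n → ℝ),
      δ * ∑ s, x s ^ 2 ≤ ∑ s, ∑ s', x s * x s' * corrMatrix a ρ p m n s s' := by
  rcases hρ0.eq_or_lt with rfl | hρ
  · refine ⟨1, one_pos, fun m n x => ?_⟩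
    rw [corrMatrix_zero hp]
    simp [Matrix.one_apply, sq]
  · obtain ⟨δ, hδ, hle⟩ := (isNegDefLength_lpLattice hp).exists_lower_bound
      (neg_pos.2 (Real.log_neg hρ hρ1))
    refine ⟨a * δ, mul_pos ha0 hδ, fun m n x => ?_⟩
    have h1 := hle (Finset.univ.map (siteEmb m n)) (Function.extend (siteEmb m n) x 0)
    simp only [Finset.sum_map, (siteEmb m n).injective.extend_apply] at h1
    have h2 : ∑ s, ∑ s', x s * x s' * corrMatrix a ρ p m n s s'
        = a * ∑ s, ∑ s', x s * x s' * Real.exp (-(-Real.log ρ *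
          lpLattice p (siteEmb m n s - siteEmb m n s'))) + (1 - a) * ∑ s, x s ^ 2 := by
      rw [Finset.mul_sum, Finset.mul_sum, ← Finset.sum_add_distrib]
      refine Finset.sum_congr rfl fun s _ => ?_
      rw [Finset.mul_sum]
      have : ∀ s', x s * x s' * corrMatrix a ρ p m n s s'
          = a * (x s * x s' * Real.exp (-(-Real.log ρ *
          lpLattice p (siteEmb m n s - siteEmb m n s')))) +
            if s = s' then (1 - a) * x s ^ 2 else 0 := by
        intro s'
        rw [corrMatrix_apply_of_pos hρ hp]
        by_cases h : s = s'
        · subst h; simp only [if_true]; ring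
        · simp only [h, if_false]; ring
      simp only [this]
      rw [Finset.sum_add_distrib, Finset.sum_ite_eq, if_pos (Finset.mem_univ _)]
    rw [h2]
    -- The multiple of the identity is nonnegative because a ≤ 1 and can be discarded, leaving the
    -- lower bound aδ.
    have h3 : 0 ≤ (1 - a) * ∑ s, x s ^ 2 :=
      mul_nonneg (by linarith) (Finset.sum_nonneg fun _ _ => sq_nonneg _)
    nlinarith

/-- The correlation matrices are bounded above, uniformly in the grid. -/
theorem exists_corrMatrix_upper_bound {a ρ p : ℝ} (ha0 : 0 < a) (ha1 : a ≤ 1) (hρ0 : 0 ≤ ρ)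
    (hρ1 : ρ < 1) (hp : 1 ≤ p) :
    ∃ C : ℝ, 0 < C ∧ ∀ (m n : ℕ) (x : Site m n → ℝ),
      ∑ s, ∑ s', x s * x s' * corrMatrix a ρ p m n s s' ≤ C * ∑ s, x s ^ 2 := by
  obtain ⟨C, hC, hrow⟩ : ∃ C : ℝ, 0 < C ∧ ∀ (m n : ℕ) (s : Site m n),
      ∑ s', corrMatrix a ρ p m n s s' ≤ C := by
    rcases hρ0.eq_or_lt with rfl | hρ
    · refine ⟨1, one_pos, fun m n s => ?_⟩
      rw [corrMatrix_zero hp]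
      simp [Matrix.one_apply]
    · have hsum := (isNegDefLength_lpLattice hp).summable _ (neg_pos.2 (Real.log_neg hρ hρ1))
      have hts : 0 ≤ ∑' k : Fin 2 → ℤ, Real.exp (-(-Real.log ρ * lpLattice p k)) :=
        tsum_nonneg fun k => (Real.exp_pos _).le
      refine ⟨_, add_pos_of_nonneg_of_pos hts one_pos, fun m n s => ?_⟩
      simp only [corrMatrix_apply_of_pos hρ hp]
      rw [Finset.sum_add_distrib, Finset.sum_ite_eq, if_pos (Finset.mem_univ _), ← Finset.mul_sum]
      refine add_le_add ?_ (by linarith)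
      set e : Site m n ↪ (Fin 2 → ℤ) := (siteEmb m n).trans
        ⟨fun k => siteEmb m n s - k, fun k k' h => sub_right_injective h⟩ with he
      have h1 := hsum.sum_le_tsum (Finset.univ.map e) fun k _ => (Real.exp_pos _).le
      rw [Finset.sum_map] at h1
      have h2 : 0 ≤ ∑ s', Real.exp (-(-Real.log ρ *
          lpLattice p (siteEmb m n s - siteEmb m n s'))) :=
        Finset.sum_nonneg fun _ _ => (Real.exp_pos _).le
      calc _ ≤ 1 * _ := mul_le_mul_of_nonneg_right ha1 h2
        _ ≤ _ := by rw [one_mul]; exact h1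
  refine ⟨C, hC, fun m n x => ?_⟩
  -- Schur test: nonnegative entries allow x s * x s' to be replaced by half the sum of squares,
  -- after which symmetry reduces everything to row sums.
  have h1 : ∑ s, ∑ s', x s * x s' * corrMatrix a ρ p m n s s' ≤
      ∑ s, ∑ s', (x s ^ 2 / 2 * corrMatrix a ρ p m n s s'
        + x s' ^ 2 / 2 * corrMatrix a ρ p m n s s') := by
    refine Finset.sum_le_sum fun s _ => Finset.sum_le_sum fun s' _ => ?_
    rw [← add_mul]
    refine mul_le_mul_of_nonneg_right ?_ (corrMatrix_nonneg ha0.le hρ0 s s')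
    nlinarith [sq_nonneg (x s - x s')]
  have h2 : ∑ s, ∑ s', x s ^ 2 / 2 * corrMatrix a ρ p m n s s' ≤ ∑ s, x s ^ 2 / 2 * C := by
    refine Finset.sum_le_sum fun s _ => ?_
    rw [← Finset.mul_sum]
    exact mul_le_mul_of_nonneg_left (hrow m n s) (by positivity)
  have h3 : ∑ s, ∑ s', x s' ^ 2 / 2 * corrMatrix a ρ p m n s s'
      = ∑ s, ∑ s', x s ^ 2 / 2 * corrMatrix a ρ p m n s s' := by
    rw [Finset.sum_comm]
    exact Finset.sum_congr rfl fun s _ => Finset.sum_congr rfl fun s' _ => by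
      rw [corrMatrix_comm]
  simp only [Finset.sum_add_distrib] at h1
  rw [h3] at h1
  have h4 : ∑ s, x s ^ 2 / 2 * C = C * (∑ s, x s ^ 2) / 2 := by
    rw [← Finset.sum_mul, ← Finset.sum_div]; ring
  linarith

/-! ### Inverses of coercive matrices -/

section Inverse

variable {ι : Type*} [Fintype ι] [DecidableEq ι] {A : Matrix ι ι ℝ} {δ : ℝ}

theorem isUnit_det_of_lower_bound (hδ : 0 < δ)
    (h : ∀ x : ι → ℝ, δ * ∑ s, x s ^ 2 ≤ ∑ s, ∑ s', x s * x s' * A s s') : IsUnit A.det := by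
  rw [isUnit_iff_ne_zero]
  intro h0
  obtain ⟨v, hv, hAv⟩ := Matrix.exists_mulVec_eq_zero_iff.2 h0
  have h1 := h v
  have h2 : ∑ s, ∑ s', v s * v s' * A s s' = 0 := by
    have : ∀ s, ∑ s', v s * v s' * A s s' = v s * (A *ᵥ v) s := by
      intro s
      rw [Matrix.mulVec, dotProduct, Finset.mul_sum]
      exact Finset.sum_congr rfl fun s' _ => by ring
    simp [this, hAv]
  rw [h2] at h1
  obtain ⟨i, hi⟩ := Function.ne_iff.1 hv
  have h3 : 0 < ∑ s, v s ^ 2 :=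
    Finset.sum_pos' (fun _ _ => sq_nonneg _) ⟨i, Finset.mem_univ i, sq_pos_of_ne_zero hi⟩
  nlinarith

/-- For y = A⁻¹x coercivity gives δ|y|² ≤ y·x, and Cauchy–Schwarz finishes; no symmetry of A enters.
-/
theorem sum_sq_inv_mulVec_le (hδ : 0 < δ)
    (h : ∀ x : ι → ℝ, δ * ∑ s, x s ^ 2 ≤ ∑ s, ∑ s', x s * x s' * A s s') (x : ι → ℝ) :
    ∑ s, (A⁻¹ *ᵥ x) s ^ 2 ≤ (δ⁻¹) ^ 2 * ∑ s, x s ^ 2 := by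
  set y := A⁻¹ *ᵥ x with hy
  have hAy : A *ᵥ y = x := by
    rw [hy, Matrix.mulVec_mulVec, Matrix.mul_nonsing_inv _ (isUnit_det_of_lower_bound hδ h),
      Matrix.one_mulVec]
  have h1 := h y
  have h2 : ∑ s, ∑ s', y s * y s' * A s s' = ∑ s, y s * x s := by
    refine Finset.sum_congr rfl fun s _ => ?_
    rw [← hAy, Matrix.mulVec, dotProduct, Finset.mul_sum]
    exact Finset.sum_congr rfl fun s' _ => by ring
  rw [h2] at h1
  have h3 := Finset.sum_mul_sq_le_sq_mul_sq Finset.univ y x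
  set Y := ∑ s, y s ^ 2
  set X := ∑ s, x s ^ 2
  have hY : 0 ≤ Y := Finset.sum_nonneg fun _ _ => sq_nonneg _
  have hX : 0 ≤ X := Finset.sum_nonneg fun _ _ => sq_nonneg _
  have h4 : (δ * Y) ^ 2 ≤ Y * X := (pow_le_pow_left₀ (by positivity) h1 2).trans h3
  rcases hY.eq_or_lt with hY0 | hY0
  · rw [← hY0]; positivity
  · have h5 : δ ^ 2 * Y ≤ X := by
      by_contra! hc
      nlinarith
    rw [inv_pow, ← div_eq_inv_mul, le_div_iff₀ (by positivity)]
    linarith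

end Inverse

/-! ### Quantitative expansion of a root -/

section LocalRoot

variable {E : Type*} [NormedAddCommGroup E] [InnerProductSpace ℝ E]

theorem mul_norm_le_of_inner_le {D : E →L[ℝ] E} {c : ℝ}
    (h : ∀ v, inner ℝ v (D v) ≤ -c * ‖v‖ ^ 2) (v : E) : c * ‖v‖ ≤ ‖D v‖ := by
  rcases (norm_nonneg v).eq_or_lt with h0 | h0
  · rw [← h0]; simp
  · have h1 := abs_real_inner_le_norm v (D v)
    have h2 := neg_abs_le (inner ℝ v (D v))
    have h3 := h v
    nlinarith

variable [FiniteDimensional ℝ E]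

/-- A map whose quadratic form is negative definite has a bounded inverse. -/
theorem exists_inverse_of_inner_le {D : E →L[ℝ] E} {c : ℝ} (hc : 0 < c)
    (h : ∀ v, inner ℝ v (D v) ≤ -c * ‖v‖ ^ 2) :
    ∃ J : E →L[ℝ] E, (∀ v, J (D v) = v) ∧ (∀ v, D (J v) = v) ∧ ∀ v, ‖J v‖ ≤ c⁻¹ * ‖v‖ := by
  have hb := mul_norm_le_of_inner_le h
  have hinj : Function.Injective (D : E →ₗ[ℝ] E) := by
    rw [injective_iff_map_eq_zero]
    intro v hv
    have h1 := hb v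
    have hv' : D v = 0 := hv
    rw [hv', norm_zero] at h1
    have : ‖v‖ ≤ 0 := by nlinarith [norm_nonneg v]
    exact norm_le_zero_iff.1 this
  set e := LinearEquiv.ofInjectiveEndo (D : E →ₗ[ℝ] E) hinj with he
  have hDe : ∀ v, D (e.symm v) = v := fun v => by
    have := e.apply_symm_apply v
    rw [he, LinearEquiv.coe_ofInjectiveEndo] at this
    exact this
  have heD : ∀ v, e.symm (D v) = v := fun v => by
    have := e.symm_apply_apply v
    rw [he, LinearEquiv.coe_ofInjectiveEndo] at this
    exact this
  refine ⟨LinearMap.toContinuousLinearMap (e.symm : E →ₗ[ℝ] E), heD, hDe, fun v => ?_⟩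
  have h1 := hb (e.symm v)
  rw [hDe] at h1
  change ‖e.symm v‖ ≤ _
  rw [inv_mul_eq_div, le_div_iff₀ hc]
  linarith

/-- First order expansion of the root of a map near `β₀` whose derivative there is a small
perturbation `D + R` of a negative definite map `D`; the remainder is quadratic in `R` and in the
value at `β₀`, and the bound also covers the points at which the perturbation is large. -/
theorem exists_root_expansion {c K : ℝ} (hc : 0 < c) (hK : 0 ≤ K) :
    ∃ r₀ : ℝ, 0 < r₀ ∧ ∀ r, 0 < r → r ≤ r₀ → ∀ B : ℝ, ∃ C : ℝ, 0 ≤ C ∧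
      ∀ (G : E → E) (D R J : E →L[ℝ] E) (β₀ b : E),
        (∀ v, inner ℝ v (D v) ≤ -c * ‖v‖ ^ 2) →
        (∀ v, J (D v) = v) → (∀ v, ‖J v‖ ≤ c⁻¹ * ‖v‖) →
        (∀ s, 0 ≤ s → s ≤ 1 → ∀ β ∈ Metric.closedBall β₀ s, ∀ β' ∈ Metric.closedBall β₀ s,
          ‖G β - G β' - (D + R) (β - β')‖ ≤ K * s * ‖β - β'‖) →
        ((∃ β ∈ Metric.ball β₀ r, G β = 0) → b ∈ Metric.ball β₀ r ∧ G b = 0) →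
        ‖b - β₀‖ ≤ B →
        ‖b - β₀ + J (G β₀)‖ ≤ C * (‖R‖ ^ 2 + ‖G β₀‖ ^ 2) := by
  -- This radius forces K r ≤ c/2, so nonlinearity in the ball never outweighs the coercivity 3c/4
  -- left after perturbation by R.
  refine ⟨min 1 (c / (2 * (K + 1))), by positivity, fun r hr hrle B => ?_⟩
  have hr1 : r ≤ 1 := hrle.trans (min_le_left _ _)
  have hKr : K * r ≤ c / 2 := by
    have h1 : r ≤ c / (2 * (K + 1)) := hrle.trans (min_le_right _ _)
    rw [le_div_iff₀ (by positivity)] at h1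
    nlinarith
  -- `C₁` serves the points where R and G β₀ are small, `C₂` the remaining ones, where only the
  -- bound B on b - β₀ is available.
  set C₁ : ℝ := c⁻¹ * (1 + (1 + K) * (16 / c ^ 2)) with hC₁
  set C₂ : ℝ := (|B| + c⁻¹) * (16 / c ^ 2 + 64 / (c * r) ^ 2) + c⁻¹ with hC₂
  have hC₁0 : 0 ≤ C₁ := by positivity
  have hC₂0 : 0 ≤ C₂ := by positivity
  refine ⟨C₁ + C₂, by positivity, ?_⟩
  intro G D R J β₀ b hD hJD hJ hG hb hB
  set x := b - β₀ with hx
  set g := ‖G β₀‖ with hg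
  have hg0 : 0 ≤ g := norm_nonneg _
  have hR0 : 0 ≤ ‖R‖ := norm_nonneg _
  by_cases hgood : ‖R‖ ≤ c / 4 ∧ g ≤ c * r / 8
  · obtain ⟨hR, hgr⟩ := hgood
    have hDR : ∀ v, inner ℝ v ((D + R) v) ≤ -(3 * c / 4) * ‖v‖ ^ 2 := by
      intro v
      rw [_root_.add_apply, inner_add_right]
      have h1 := hD v
      have h2 := real_inner_le_norm v (R v)
      have h3 := R.le_opNorm v
      have h4 : ‖v‖ * ‖R v‖ ≤ ‖v‖ * (c / 4 * ‖v‖) :=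
        mul_le_mul_of_nonneg_left (h3.trans (mul_le_mul_of_nonneg_right hR (norm_nonneg _)))
          (norm_nonneg _)
      nlinarith
    have h34 : 0 < 3 * c / 4 := by positivity
    obtain ⟨J', -, hDJ', hJ'⟩ := exists_inverse_of_inner_le h34 hDR
    have happ : ApproximatesLinearOn G (D + R) (Metric.closedBall β₀ (r / 2))
        (Real.toNNReal (K * (r / 2))) := by
      intro β hβ β' hβ'
      rw [Real.coe_toNNReal _ (by positivity)]
      exact hG (r / 2) (by positivity) (by linarith) β hβ β' hβ'
    -- The image of the ball of radius r/2 contains a ball about G β₀ of radius (3c/4 - K r/2) r/2 ≥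
    -- c r/4, hence contains 0. Using r/2 places the root inside the open ball of radius r.
    have hsurj := happ.surjOn_closedBall_of_nonlinearRightInverse
      { toFun := J', nnnorm := Real.toNNReal (3 * c / 4)⁻¹,
        bound' := fun y => by
          rw [Real.coe_toNNReal _ (by positivity)]; exact hJ' y,
        right_inv' := hDJ' } (ε := r / 2) (b := β₀) (by positivity) subset_rfl
    simp only at hsurj
    rw [Real.coe_toNNReal _ (by positivity), Real.coe_toNNReal _ (by positivity), inv_inv] at hsurj
    obtain ⟨β, hβ, hβ0⟩ := hsurj (show (0 : E) ∈ _ by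
      rw [Metric.mem_closedBall, dist_zero_left]
      change g ≤ _
      nlinarith)
    obtain ⟨hbr, hGb⟩ := hb ⟨β, Metric.closedBall_subset_ball (by linarith) hβ, hβ0⟩
    rw [mem_ball_iff_norm, ← hx] at hbr
    -- Taking the radius equal to the distance from b to `β₀` makes the remainder quadratic in x.
    have hrem := hG ‖x‖ (norm_nonneg _) (by linarith) b
      (by rw [mem_closedBall_iff_norm]) β₀ (Metric.mem_closedBall_self (norm_nonneg _))
    rw [← hx, hGb, zero_sub] at hrem
    set rem := -G β₀ - (D + R) x with hremdef
    -- Coercivity 3c/4 absorbs a remainder of at most c/2 times ‖x‖. This holds for any root in the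
    -- ball, so uniqueness is not needed.
    have hxg : ‖x‖ ≤ 4 / c * g := by
      have h1 := hDR x
      have h2 : inner ℝ x ((D + R) x) = - inner ℝ x (G β₀) - inner ℝ x rem := by
        rw [hremdef, inner_sub_right, inner_neg_right]; ring
      have h3 := real_inner_le_norm x (G β₀)
      have h4 := real_inner_le_norm x rem
      have h5 : ‖x‖ * ‖rem‖ ≤ ‖x‖ * (c / 2 * ‖x‖) := by
        refine mul_le_mul_of_nonneg_left (hrem.trans ?_) (norm_nonneg _)
        refine mul_le_mul_of_nonneg_right ?_ (norm_nonneg _)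
        exact (mul_le_mul_of_nonneg_left hbr.le hK).trans hKr
      rcases (norm_nonneg x).eq_or_lt with h0 | h0
      · rw [← h0]; positivity
      · have h6 : ‖x‖ * (c / 4 * ‖x‖) ≤ ‖x‖ * g := by rw [hg]; nlinarith
        have h7 := le_of_mul_le_mul_left h6 h0
        rw [div_mul_eq_mul_div, le_div_iff₀ hc]
        linarith
    have hkey : x + J (G β₀) = J (-(R x) - rem) := by
      have h1 : -(R x) - rem = D x + G β₀ := by
        rw [hremdef, _root_.add_apply]; abel
      rw [h1, map_add, hJD]
    rw [hkey]
    have h1 : ‖-(R x) - rem‖ ≤ ‖R‖ * ‖x‖ + K * ‖x‖ * ‖x‖ := by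
      refine (norm_sub_le _ _).trans (add_le_add ?_ hrem)
      rw [norm_neg]; exact R.le_opNorm x
    have h2 : ‖x‖ ^ 2 ≤ 16 / c ^ 2 * g ^ 2 := by
      calc ‖x‖ ^ 2 ≤ (4 / c * g) ^ 2 := pow_le_pow_left₀ (norm_nonneg _) hxg 2
        _ = _ := by ring
    have h3 : ‖R‖ * ‖x‖ + K * ‖x‖ * ‖x‖ ≤ ‖R‖ ^ 2 + (1 + K) * ‖x‖ ^ 2 := by
      nlinarith [sq_nonneg (‖R‖ - ‖x‖), sq_nonneg ‖R‖, sq_nonneg ‖x‖]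
    have h4 : ‖R‖ ^ 2 + (1 + K) * ‖x‖ ^ 2 ≤
        (1 + (1 + K) * (16 / c ^ 2)) * (‖R‖ ^ 2 + g ^ 2) := by
      have h5 : (1 + K) * ‖x‖ ^ 2 ≤ (1 + K) * (16 / c ^ 2 * g ^ 2) :=
        mul_le_mul_of_nonneg_left h2 (by positivity)
      have h6 : 0 ≤ (1 + K) * (16 / c ^ 2) * ‖R‖ ^ 2 := by positivity
      nlinarith [sq_nonneg g]
    calc _ ≤ c⁻¹ * ‖-(R x) - rem‖ := hJ _
      _ ≤ c⁻¹ * ((1 + (1 + K) * (16 / c ^ 2)) * (‖R‖ ^ 2 + g ^ 2)) :=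
          mul_le_mul_of_nonneg_left (h1.trans (h3.trans h4)) (by positivity)
      _ = C₁ * (‖R‖ ^ 2 + g ^ 2) := by rw [hC₁]; ring
      _ ≤ _ := mul_le_mul_of_nonneg_right (by linarith) (by positivity)
  -- A Chebyshev bound in pointwise form: where a threshold c/4 or c r/8 is exceeded, the
  -- corresponding scaled square is already at least 1.
  · have hbad : 1 ≤ (16 / c ^ 2 + 64 / (c * r) ^ 2) * (‖R‖ ^ 2 + g ^ 2) := by
      have p1 : 0 ≤ 16 / c ^ 2 := by positivity
      have p2 : 0 ≤ 64 / (c * r) ^ 2 := by positivity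
      have q1 := sq_nonneg ‖R‖
      have q2 := sq_nonneg g
      rw [not_and_or, not_le, not_le] at hgood
      rcases hgood with h | h
      · have h1 : (c / 4) ^ 2 ≤ ‖R‖ ^ 2 := pow_le_pow_left₀ (by positivity) h.le 2
        have h2 : 1 ≤ 16 / c ^ 2 * ‖R‖ ^ 2 := by
          rw [div_mul_eq_mul_div, le_div_iff₀ (by positivity)]; linarith
        nlinarith [mul_nonneg p1 q2, mul_nonneg p2 q1, mul_nonneg p2 q2]
      · have h1 : (c * r / 8) ^ 2 ≤ g ^ 2 := pow_le_pow_left₀ (by positivity) h.le 2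
        have h2 : 1 ≤ 64 / (c * r) ^ 2 * g ^ 2 := by
          rw [div_mul_eq_mul_div, le_div_iff₀ (by positivity)]; linarith
        nlinarith [mul_nonneg p1 q2, mul_nonneg p2 q1, mul_nonneg p1 q1]
    have h1 : ‖x + J (G β₀)‖ ≤ |B| + c⁻¹ * g :=
      (norm_add_le _ _).trans (add_le_add (hB.trans (le_abs_self B)) (hJ _))
    have hc' : 0 < c⁻¹ := by positivity
    have h2 : c⁻¹ * g ≤ c⁻¹ + c⁻¹ * (‖R‖ ^ 2 + g ^ 2) := by
      have : g ≤ 1 + (‖R‖ ^ 2 + g ^ 2) := by nlinarith [sq_nonneg (g - 1), sq_nonneg ‖R‖]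
      calc c⁻¹ * g ≤ c⁻¹ * (1 + (‖R‖ ^ 2 + g ^ 2)) := mul_le_mul_of_nonneg_left this hc'.le
        _ = _ := by ring
    have h3 : |B| + c⁻¹ ≤ (|B| + c⁻¹) * ((16 / c ^ 2 + 64 / (c * r) ^ 2) * (‖R‖ ^ 2 + g ^ 2)) :=
      le_mul_of_one_le_right (by positivity) hbad
    calc _ ≤ (|B| + c⁻¹) + c⁻¹ * (‖R‖ ^ 2 + g ^ 2) := by linarith
      _ ≤ C₂ * (‖R‖ ^ 2 + g ^ 2) := by rw [hC₂, add_mul]; linarith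
      _ ≤ _ := mul_le_mul_of_nonneg_right (by linarith) (by positivity)

end LocalRoot

/-! ### Scalar Taylor bounds and the logistic link -/

/-- Uniform first order Taylor estimates on a compact interval for a `C²` function. -/
theorem exists_taylor_bound {f : ℝ → ℝ} (hf : ContDiff ℝ 2 f) (L : ℝ) :
    ∃ C : ℝ, 0 ≤ C ∧ (∀ x ∈ Set.Icc (-L) L, |f x| ≤ C) ∧
      (∀ x ∈ Set.Icc (-L) L, |deriv f x| ≤ C) ∧
      (∀ x ∈ Set.Icc (-L) L, ∀ y ∈ Set.Icc (-L) L, |f x - f y| ≤ C * |x - y|) ∧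
      ∀ x ∈ Set.Icc (-L) L, ∀ y ∈ Set.Icc (-L) L, ∀ z ∈ Set.Icc (-L) L, ∀ h,
        |x - z| ≤ h → |y - z| ≤ h → |f x - f y - deriv f z * (x - y)| ≤ C * h * |x - y| := by
  have hd : ContDiff ℝ 1 (deriv f) := by
    have : ContDiff ℝ (1 + 1) f := by rw [one_add_one_eq_two]; exact hf
    exact (contDiff_succ_iff_deriv.1 this).2.2
  have hd2 : Continuous (deriv (deriv f)) := hd.continuous_deriv le_rfl
  have hdiff : Differentiable ℝ f := hf.differentiable (by norm_num)
  have hdiff1 : Differentiable ℝ (deriv f) := hd.differentiable (by norm_num)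
  obtain ⟨C₀, h0⟩ := isCompact_Icc.exists_bound_of_continuousOn (s := Set.Icc (-L) L)
    hf.continuous.continuousOn
  obtain ⟨C₁, h1⟩ := isCompact_Icc.exists_bound_of_continuousOn (s := Set.Icc (-L) L)
    hd.continuous.continuousOn
  obtain ⟨C₂, h2⟩ := isCompact_Icc.exists_bound_of_continuousOn (s := Set.Icc (-L) L)
    hd2.continuousOn
  have hC0 := le_abs_self C₀
  have hC1 := le_abs_self C₁
  have hC2 := le_abs_self C₂
  have a0 := abs_nonneg C₀
  have a1 := abs_nonneg C₁
  have a2 := abs_nonneg C₂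
  refine ⟨|C₀| + |C₁| + |C₂|, by positivity, ?_, ?_, ?_, ?_⟩
  · intro x hx; exact (h0 x hx).trans (by linarith)
  · intro x hx; exact (h1 x hx).trans (by linarith)
  · intro x hx y hy
    have := (convex_Icc (-L) L).norm_image_sub_le_of_norm_deriv_le (f := f) (C := C₁)
      (fun t _ => hdiff t) h1 hy hx
    refine this.trans (mul_le_mul_of_nonneg_right (by linarith) (norm_nonneg _))
  · intro x hx y hy z hz h hxz hyz
    have hlip : ∀ t ∈ Set.Icc (-L) L, |deriv f t - deriv f z| ≤ |C₂| * |t - z| := by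
      intro t ht
      have := (convex_Icc (-L) L).norm_image_sub_le_of_norm_deriv_le (f := deriv f) (C := C₂)
        (fun t _ => hdiff1 t) h2 hz ht
      exact this.trans (mul_le_mul_of_nonneg_right hC2 (norm_nonneg _))
    -- Subtracting the tangent slope at z leaves a function with derivative O(h) on a convex set
    -- containing x and y, so the mean value inequality gives the estimate.
    have hmem : ∀ t ∈ Set.Icc (-L) L ∩ Metric.closedBall z h,
        ‖deriv (fun t => f t - deriv f z * t) t‖ ≤ |C₂| * h := by
      intro t ht
      have : deriv (fun t => f t - deriv f z * t) t = deriv f t - deriv f z := by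
        rw [deriv_fun_sub (hdiff t) (by fun_prop), deriv_const_mul_field]
        simp
      rw [this]
      refine (hlip t ht.1).trans (mul_le_mul_of_nonneg_left ?_ a2)
      simpa [Real.dist_eq] using ht.2
    have hconv := (convex_Icc (-L) L).inter (convex_closedBall z h)
    have := hconv.norm_image_sub_le_of_norm_deriv_le (f := fun t => f t - deriv f z * t)
      (fun t _ => by fun_prop) hmem (x := y) (y := x)
      ⟨hy, by simpa [Real.dist_eq] using hyz⟩ ⟨hx, by simpa [Real.dist_eq] using hxz⟩
    have e : f x - deriv f z * x - (f y - deriv f z * y) = f x - f y - deriv f z * (x - y) := by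
      ring
    rw [e] at this
    have hh : 0 ≤ h := (abs_nonneg _).trans hxz
    refine this.trans (mul_le_mul_of_nonneg_right ?_ (norm_nonneg _))
    exact mul_le_mul_of_nonneg_right (by linarith) hh

/-- The logistic function. -/
noncomputable def logistic (η : ℝ) : ℝ := Real.exp η / (1 + Real.exp η)

/-- The standard deviation of a binary response with logit `η`. -/
noncomputable def logisticSD (η : ℝ) : ℝ := Real.exp (η / 2) / (1 + Real.exp η)

/-- The standardised residual of a binary response `y` with logit `η`. -/
noncomputable def stdResidual (y η : ℝ) : ℝ :=
  y * Real.exp (-(η / 2)) - (1 - y) * Real.exp (η / 2)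

theorem exp_eq_sq_exp_half (η : ℝ) : Real.exp η = Real.exp (η / 2) ^ 2 := by
  rw [← Real.exp_nat_mul]; congr 1; push_cast; ring

theorem logisticSD_pos (η : ℝ) : 0 < logisticSD η := by unfold logisticSD; positivity

theorem logisticSD_sq (η : ℝ) : logisticSD η ^ 2 = logistic η * (1 - logistic η) := by
  unfold logisticSD logistic
  have h := exp_eq_sq_exp_half η
  have : 1 + Real.exp η ≠ 0 := by positivity
  field_simp
  rw [h]; ring

/-- This identifies `stdResidual` as (y - θ)/σ. In exponential form it is visibly smooth in η, and a
binary response leaves only two functions to estimate. -/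
theorem logisticSD_mul_stdResidual (y η : ℝ) : logisticSD η * stdResidual y η = y - logistic η := by
  unfold logisticSD logistic stdResidual
  rw [Real.exp_neg, exp_eq_sq_exp_half η]
  have h1 : 1 + Real.exp (η / 2) ^ 2 ≠ 0 := by positivity
  have h2 : Real.exp (η / 2) ≠ 0 := by positivity
  field_simp
  ring

theorem logistic_mem (η : ℝ) : 0 < logistic η ∧ logistic η < 1 := by
  unfold logistic
  refine ⟨by positivity, ?_⟩
  rw [div_lt_one (by positivity)]
  linarith

theorem abs_logistic_sub_half_le (η : ℝ) : |logistic η - 1 / 2| ≤ 1 := by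
  have := logistic_mem η
  rw [abs_le]; constructor <;> linarith [this.1, this.2]

theorem logisticSD_le_one (η : ℝ) : logisticSD η ≤ 1 := by
  have h1 := logisticSD_sq η
  have h2 := logistic_mem η
  have h3 := logisticSD_pos η
  nlinarith [h2.1, h2.2]

theorem deriv_logisticSD (η : ℝ) :
    deriv logisticSD η = -((logistic η - 1 / 2) * logisticSD η) := by
  have h1 : 1 + Real.exp η ≠ 0 := by positivity
  have h2 : HasDerivAt (fun η : ℝ => Real.exp (η / 2)) (Real.exp (η / 2) * (1 / 2)) η :=
    ((hasDerivAt_id η).div_const 2).exp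
  have h3 : HasDerivAt (fun η : ℝ => 1 + Real.exp η) (Real.exp η) η :=
    (Real.hasDerivAt_exp η).const_add 1
  have h4 := (h2.div h3 h1).deriv
  change deriv (fun η : ℝ => Real.exp (η / 2) / (1 + Real.exp η)) η = _
  refine h4.trans ?_
  unfold logistic logisticSD
  field_simp
  ring

theorem deriv_stdResidual {y : ℝ} (hy : y = 0 ∨ y = 1) (η : ℝ) :
    deriv (stdResidual y) η = (logistic η - 1 / 2) * stdResidual y η - logisticSD η := by
  have h2 : HasDerivAt (fun η : ℝ => Real.exp (η / 2)) (Real.exp (η / 2) * (1 / 2)) η :=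
    ((hasDerivAt_id η).div_const 2).exp
  have h3 : HasDerivAt (fun η : ℝ => Real.exp (-(η / 2))) (Real.exp (-(η / 2)) * (-(1 / 2))) η :=
    ((hasDerivAt_id η).div_const 2).neg.exp
  have h4 := ((h3.const_mul y).sub (h2.const_mul (1 - y))).deriv
  refine Eq.trans ?_ (h4.trans ?_)
  · rfl
  · unfold logistic logisticSD stdResidual
    rw [Real.exp_neg, exp_eq_sq_exp_half η]
    have h1 : 1 + Real.exp (η / 2) ^ 2 ≠ 0 := by positivity
    have h2 : Real.exp (η / 2) ≠ 0 := by positivity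
    rcases hy with rfl | rfl
    · field_simp; ring
    · field_simp; ring

theorem contDiff_logisticSD : ContDiff ℝ 2 logisticSD := by
  unfold logisticSD
  exact ContDiff.div (by fun_prop) (by fun_prop) fun η => by positivity

theorem contDiff_stdResidual (y : ℝ) : ContDiff ℝ 2 (stdResidual y) := by
  unfold stdResidual; fun_prop

/-! ### Bilinear forms in the inverse correlation matrix -/

section Bilinear

variable {ι : Type*} [Fintype ι]

/-- Expansion of a bounded bilinear expression whose two entries have first order expansions. -/
theorem abs_bilinear_expansion_le {Q : Matrix ι ι ℝ} {κ : ℝ}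
    (hQ : ∀ (x y : ι → ℝ) (a b : ℝ), 0 ≤ a → 0 ≤ b → (∀ i, |x i| ≤ a) → (∀ i, |y i| ≤ b) →
      |x ⬝ᵥ Q *ᵥ y| ≤ κ * a * b)
    {A A' A₀ dA B B' B₀ dB : ι → ℝ} {C s t : ℝ} (hC : 0 ≤ C) (hs : 0 ≤ s) (ht : 0 ≤ t)
    (hA' : ∀ i, |A' i| ≤ C) (hB : ∀ i, |B i| ≤ C)
    (hdA : ∀ i, |dA i| ≤ C * t) (hdB : ∀ i, |dB i| ≤ C * t)
    (hA₀ : ∀ i, |A' i - A₀ i| ≤ C * s) (hB₀ : ∀ i, |B i - B₀ i| ≤ C * s)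
    (hAA : ∀ i, |A i - A' i - dA i| ≤ C * s * t) (hBB : ∀ i, |B i - B' i - dB i| ≤ C * s * t) :
    |A ⬝ᵥ Q *ᵥ B - A' ⬝ᵥ Q *ᵥ B' - (dA ⬝ᵥ Q *ᵥ B₀ + A₀ ⬝ᵥ Q *ᵥ dB)|
      ≤ 4 * κ * C ^ 2 * s * t := by
  -- The error telescopes into four terms, each containing one second order factor or two first
  -- order ones.
  have e : A ⬝ᵥ Q *ᵥ B - A' ⬝ᵥ Q *ᵥ B' - (dA ⬝ᵥ Q *ᵥ B₀ + A₀ ⬝ᵥ Q *ᵥ dB)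
      = (A - A' - dA) ⬝ᵥ Q *ᵥ B + dA ⬝ᵥ Q *ᵥ (B - B₀) + A' ⬝ᵥ Q *ᵥ (B - B' - dB)
        + (A' - A₀) ⬝ᵥ Q *ᵥ dB := by
    simp only [sub_dotProduct, Matrix.mulVec_sub, dotProduct_sub]
    ring
  rw [e]
  have h1 := hQ (A - A' - dA) B (C * s * t) C (by positivity) hC hAA hB
  have h2 := hQ dA (B - B₀) (C * t) (C * s) (by positivity) (by positivity) hdA hB₀
  have h3 := hQ A' (B - B' - dB) C (C * s * t) hC (by positivity) hA' hBB
  have h4 := hQ (A' - A₀) dB (C * s) (C * t) (by positivity) (by positivity) hA₀ hdB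
  refine (abs_add_le _ _).trans ((add_le_add (((abs_add_le _ _).trans
    (add_le_add ((abs_add_le _ _).trans (add_le_add h1 h2)) h3))) h4).trans_eq ?_)
  ring

/-- Cauchy–Schwarz and the bound on the inverse cost one factor √N per vector; this is the factor N
removed by normalising the score. -/
theorem abs_dotProduct_inv_mulVec_le [DecidableEq ι] {A : Matrix ι ι ℝ} {δ : ℝ} (hδ : 0 < δ)
    (h : ∀ x : ι → ℝ, δ * ∑ s, x s ^ 2 ≤ ∑ s, ∑ s', x s * x s' * A s s')
    (x y : ι → ℝ) (a b : ℝ) (ha : 0 ≤ a) (hb : 0 ≤ b) (hx : ∀ i, |x i| ≤ a)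
    (hy : ∀ i, |y i| ≤ b) :
    |x ⬝ᵥ A⁻¹ *ᵥ y| ≤ (δ⁻¹ * Fintype.card ι) * a * b := by
  refine abs_le_of_sq_le_sq ?_ (by positivity)
  have h1 := Finset.sum_mul_sq_le_sq_mul_sq Finset.univ x (A⁻¹ *ᵥ y)
  have h2 := sum_sq_inv_mulVec_le hδ h y
  have hsum : ∀ (z : ι → ℝ) (c : ℝ), (∀ i, |z i| ≤ c) → ∑ i, z i ^ 2 ≤ Fintype.card ι * c ^ 2 := by
    intro z c hz
    have : ∑ i, z i ^ 2 ≤ ∑ _i : ι, c ^ 2 :=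
      Finset.sum_le_sum fun i _ => sq_le_sq' (abs_le.1 (hz i)).1 (abs_le.1 (hz i)).2
    simpa using this
  have h3 := hsum x a hx
  have h4 := hsum y b hy
  calc (x ⬝ᵥ A⁻¹ *ᵥ y) ^ 2 ≤ (∑ i, x i ^ 2) * ∑ i, (A⁻¹ *ᵥ y) i ^ 2 := h1
    _ ≤ (Fintype.card ι * a ^ 2) * ((δ⁻¹) ^ 2 * (Fintype.card ι * b ^ 2)) := by
        refine mul_le_mul h3 (h2.trans (mul_le_mul_of_nonneg_left h4 (by positivity)))
          (Finset.sum_nonneg fun _ _ => sq_nonneg _) (by positivity)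
    _ = _ := by ring

end Bilinear

/-! ### The quasi-score and its expansion -/

section Score

variable {m n u : ℕ} (T : Matrix (Site m n) (Fin (u + 1)) ℝ) (β : EuclideanSpace ℝ (Fin (u + 1)))

/-- The linear predictor. -/
noncomputable def eta (s : Site m n) : ℝ := ∑ j, T s j * β j

theorem theta_eq_logistic (s : Site m n) : theta T β s = logistic (eta T β s) := rfl

theorem sigma_eq_logisticSD (s : Site m n) : sigma T β s = logisticSD (eta T β s) := by
  rw [sigma, theta_eq_logistic, ← logisticSD_sq, Real.sqrt_sq (logisticSD_pos _).le]

theorem eta_sub (β β' : EuclideanSpace ℝ (Fin (u + 1))) (s : Site m n) :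
    eta T (β - β') s = eta T β s - eta T β' s := by
  simp [eta, mul_sub, Finset.sum_sub_distrib]

variable {T}

theorem abs_design_le (hT : IsBinaryDesign T) (s : Site m n) (j : Fin (u + 1)) : |T s j| ≤ 1 := by
  rcases (hT s).2 j with h | h <;> simp [h]

theorem abs_eta_le (hT : IsBinaryDesign T) (s : Site m n) : |eta T β s| ≤ (u + 1) * ‖β‖ := by
  have : ∑ j, |T s j * β j| ≤ ∑ _j : Fin (u + 1), ‖β‖ := by
    refine Finset.sum_le_sum fun j _ => ?_
    rw [abs_mul]
    calc _ ≤ 1 * ‖β‖ := mul_le_mul (abs_design_le hT s j) (PiLp.norm_apply_le β j)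
          (abs_nonneg _) zero_le_one
      _ = _ := one_mul _
  refine (Finset.abs_sum_le_sum_abs _ _).trans (this.trans_eq ?_)
  simp

variable (T)

/-- The `j`th column of `S T`, the design matrix with rows scaled by the standard deviations. -/
noncomputable def scaledDesign (j : Fin (u + 1)) (s : Site m n) : ℝ :=
  T s j * logisticSD (eta T β s)

/-- The vector of standardised residuals. -/
noncomputable def residuals (y : Site m n → ℝ) (s : Site m n) : ℝ := stdResidual (y s) (eta T β s)

/-- With S the diagonal of standard deviations, V = SΓS and P = S²T, so PᵀV⁻¹(y - θ) = (ST)ᵀΓ⁻¹S⁻¹(y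
- θ). The inverse no longer depends on β. -/
theorem quasiScore_apply {a ρ p : ℝ} (hΓ : IsUnit (corrMatrix a ρ p m n).det) (y : Site m n → ℝ)
    (j : Fin (u + 1)) :
    quasiScore T β a ρ p y j
      = scaledDesign T β j ⬝ᵥ (corrMatrix a ρ p m n)⁻¹ *ᵥ residuals T β y := by
  set Q := (corrMatrix a ρ p m n)⁻¹ with hQ
  set sd : Site m n → ℝ := fun s => logisticSD (eta T β s) with hsd
  have hsd0 : ∀ s, sd s ≠ 0 := fun s => (logisticSD_pos _).ne'
  have hV : covMatrix T β a ρ p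
      = Matrix.diagonal sd * corrMatrix a ρ p m n * Matrix.diagonal sd := by
    ext s s'
    rw [Matrix.mul_diagonal, Matrix.diagonal_mul, covMatrix, Matrix.of_apply, sigma_eq_logisticSD,
      sigma_eq_logisticSD]
    ring
  have hdd : Matrix.diagonal sd * Matrix.diagonal (fun s => (sd s)⁻¹) = 1 := by
    rw [Matrix.diagonal_mul_diagonal, ← Matrix.diagonal_one]
    congr 1; ext s; exact mul_inv_cancel₀ (hsd0 s)
  have hinv : (covMatrix T β a ρ p)⁻¹
      = Matrix.diagonal (fun s => (sd s)⁻¹) * Q * Matrix.diagonal (fun s => (sd s)⁻¹) := by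
    refine Matrix.inv_eq_right_inv ?_
    rw [hV]
    calc _ = Matrix.diagonal sd * corrMatrix a ρ p m n *
          (Matrix.diagonal sd * Matrix.diagonal (fun s => (sd s)⁻¹)) * Q *
            Matrix.diagonal (fun s => (sd s)⁻¹) := by simp only [Matrix.mul_assoc]
      _ = Matrix.diagonal sd * (corrMatrix a ρ p m n * Q) *
            Matrix.diagonal (fun s => (sd s)⁻¹) := by
          rw [hdd, Matrix.mul_one, Matrix.mul_assoc (Matrix.diagonal sd)]
      _ = 1 := by rw [hQ, Matrix.mul_nonsing_inv _ hΓ, Matrix.mul_one, hdd]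
  have hres : Matrix.diagonal (fun s => (sd s)⁻¹) *ᵥ (y - theta T β) = residuals T β y := by
    ext s
    rw [Matrix.mulVec_diagonal, Pi.sub_apply, theta_eq_logistic, ← logisticSD_mul_stdResidual,
      residuals]
    exact inv_mul_cancel_left₀ (hsd0 s) _
  have hP : (derivMatrix T β)ᵀ * Matrix.diagonal (fun s => (sd s)⁻¹)
      = Matrix.of fun j s => scaledDesign T β j s := by
    ext j s
    rw [Matrix.mul_diagonal, Matrix.transpose_apply, derivMatrix, Matrix.of_apply,
      Matrix.of_apply, theta_eq_logistic, ← logisticSD_sq, scaledDesign]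
    change T s j * sd s ^ 2 * (sd s)⁻¹ = T s j * sd s
    field_simp [hsd0 s]
  have : ((derivMatrix T β)ᵀ * (covMatrix T β a ρ p)⁻¹) *ᵥ (y - theta T β)
      = (Matrix.of fun j s => scaledDesign T β j s) *ᵥ (Q *ᵥ residuals T β y) := by
    rw [hinv, ← hres, ← hP]
    simp only [Matrix.mulVec_mulVec, Matrix.mul_assoc]
  change (((derivMatrix T β)ᵀ * (covMatrix T β a ρ p)⁻¹) *ᵥ (y - theta T β)) j = _
  rw [this]
  rfl

/-- The deviation of the mean response from `1 / 2`. -/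
noncomputable def skew (s : Site m n) : ℝ := logistic (eta T β s) - 1 / 2

/-- The matrix of the expected derivative `-Pᵀ V⁻¹ P` of the quasi-score. -/
noncomputable def meanDeriv (Q : Matrix (Site m n) (Site m n) ℝ) :
    Matrix (Fin (u + 1)) (Fin (u + 1)) ℝ :=
  Matrix.of fun j k => -(scaledDesign T β j ⬝ᵥ Q *ᵥ scaledDesign T β k)

/-- The matrix of the centred derivative of the quasi-score, a linear function of the standardised
residuals `z`. -/
noncomputable def fluctDeriv (Q : Matrix (Site m n) (Site m n) ℝ) (z : Site m n → ℝ) :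
    Matrix (Fin (u + 1)) (Fin (u + 1)) ℝ :=
  Matrix.of fun j k => -((fun s => skew T β s * scaledDesign T β j s * T s k) ⬝ᵥ Q *ᵥ z)
    + scaledDesign T β j ⬝ᵥ Q *ᵥ fun s => skew T β s * T s k * z s

theorem dotProduct_mulVec_sum {ι κ : Type*} [Fintype ι] [Fintype κ] (Q : Matrix ι ι ℝ)
    (x : ι → ℝ) (f : κ → ι → ℝ) (v : κ → ℝ) :
    (x ⬝ᵥ Q *ᵥ fun i => ∑ k, f k i * v k) = ∑ k, (x ⬝ᵥ Q *ᵥ f k) * v k := by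
  have : (fun i => ∑ k, f k i * v k) = ∑ k, v k • f k := by
    ext i; simp [mul_comm]
  rw [this, Matrix.mulVec_sum, dotProduct_sum]
  refine Finset.sum_congr rfl fun k _ => ?_
  rw [Matrix.mulVec_smul, dotProduct_smul, smul_eq_mul, mul_comm]

theorem sum_dotProduct_mulVec {ι κ : Type*} [Fintype ι] [Fintype κ] (Q : Matrix ι ι ℝ)
    (x : ι → ℝ) (f : κ → ι → ℝ) (v : κ → ℝ) :
    ((fun i => ∑ k, f k i * v k) ⬝ᵥ Q *ᵥ x) = ∑ k, (f k ⬝ᵥ Q *ᵥ x) * v k := by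
  have : (fun i => ∑ k, f k i * v k) = ∑ k, v k • f k := by
    ext i; simp [mul_comm]
  rw [this, sum_dotProduct]
  refine Finset.sum_congr rfl fun k _ => ?_
  rw [smul_dotProduct, smul_eq_mul, mul_comm]

/-- The right side is the product rule for the bilinear score: the -σ part of the residual
derivative gives `meanDeriv`, and all terms linear in z give `fluctDeriv`. -/
theorem deriv_mulVec_apply (Q : Matrix (Site m n) (Site m n) ℝ) (z : Site m n → ℝ)
    (v : EuclideanSpace ℝ (Fin (u + 1))) (j : Fin (u + 1)) :
    ((meanDeriv T β Q + fluctDeriv T β Q z) *ᵥ v.ofLp) j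
      = (fun s => T s j * (-(skew T β s * logisticSD (eta T β s)) * eta T v s)) ⬝ᵥ Q *ᵥ z
        + scaledDesign T β j ⬝ᵥ Q *ᵥ
            fun s => (skew T β s * z s - logisticSD (eta T β s)) * eta T v s := by
  have e1 : (fun s => T s j * (-(skew T β s * logisticSD (eta T β s)) * eta T v s))
      = fun s => ∑ k, -(skew T β s * scaledDesign T β j s * T s k) * v k := by
    ext s
    simp only [eta, scaledDesign, Finset.mul_sum]
    exact Finset.sum_congr rfl fun k _ => by ring
  have e2 : (fun s => (skew T β s * z s - logisticSD (eta T β s)) * eta T v s)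
      = fun s => ∑ k, (skew T β s * T s k * z s - scaledDesign T β k s) * v k := by
    ext s
    have : eta T v s = ∑ k, T s k * v k := rfl
    rw [this, Finset.mul_sum]
    simp only [scaledDesign]
    exact Finset.sum_congr rfl fun k _ => by ring
  rw [e1, e2, dotProduct_mulVec_sum Q _
    (fun k s => skew T β s * T s k * z s - scaledDesign T β k s),
    sum_dotProduct_mulVec Q _ (fun k s => -(skew T β s * scaledDesign T β j s * T s k)),
    ← Finset.sum_add_distrib, Matrix.mulVec, dotProduct]
  refine Finset.sum_congr rfl fun k _ => ?_
  have e3 : (fun s => skew T β s * T s k * z s - scaledDesign T β k s)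
      = (fun s => skew T β s * T s k * z s) - scaledDesign T β k := rfl
  have e4 : (fun s => -(skew T β s * scaledDesign T β j s * T s k))
      = -(fun s => skew T β s * scaledDesign T β j s * T s k) := rfl
  rw [e3, e4, Matrix.mulVec_sub, dotProduct_sub, neg_dotProduct, Matrix.add_apply, meanDeriv,
    fluctDeriv, Matrix.of_apply, Matrix.of_apply]
  ring

end Score

theorem euclidean_norm_le_of_abs_le {k : ℕ} (v : EuclideanSpace ℝ (Fin k)) {c : ℝ} (hc : 0 ≤ c)
    (h : ∀ j, |v j| ≤ c) : ‖v‖ ≤ k * c := by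
  rw [EuclideanSpace.norm_eq]
  refine Real.sqrt_le_iff.2 ⟨by positivity, ?_⟩
  have h1 : ∑ j, ‖v j‖ ^ 2 ≤ ∑ _j : Fin k, c ^ 2 :=
    Finset.sum_le_sum fun j _ => pow_le_pow_left₀ (norm_nonneg _) (h j) 2
  refine h1.trans ?_
  simp only [Finset.sum_const, Finset.card_univ, Fintype.card_fin, nsmul_eq_mul]
  rw [mul_pow]
  refine mul_le_mul_of_nonneg_right ?_ (sq_nonneg _)
  rcases Nat.eq_zero_or_pos k with rfl | hk
  · simp
  · have : (1 : ℝ) ≤ k := by exact_mod_cast hk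
    nlinarith

/-- First order expansion of the quasi-score, with constants uniform in the grid, in the design and
in the responses. -/
theorem exists_quasiScore_expansion {u : ℕ} (β₀ : EuclideanSpace ℝ (Fin (u + 1))) {a ρ p δ : ℝ}
    (hδ : 0 < δ) (hΓ : ∀ (m n : ℕ) (x : Site m n → ℝ),
      δ * ∑ s, x s ^ 2 ≤ ∑ s, ∑ s', x s * x s' * corrMatrix a ρ p m n s s') :
    ∃ K : ℝ, 0 ≤ K ∧ ∀ (m n : ℕ) (T : Matrix (Site m n) (Fin (u + 1)) ℝ), IsBinaryDesign T →
      ∀ y : Site m n → ℝ, (∀ s, y s = 0 ∨ y s = 1) →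
      ∀ t, 0 ≤ t → t ≤ 1 → ∀ β ∈ Metric.closedBall β₀ t, ∀ β' ∈ Metric.closedBall β₀ t,
        ‖quasiScore T β a ρ p y - quasiScore T β' a ρ p y -
          Matrix.toEuclideanCLM (𝕜 := ℝ) (meanDeriv T β₀ (corrMatrix a ρ p m n)⁻¹
            + fluctDeriv T β₀ (corrMatrix a ρ p m n)⁻¹ (residuals T β₀ y)) (β - β')‖
          ≤ K * ((m * n : ℕ) : ℝ) * t * ‖β - β'‖ := by
  set c₁ : ℝ := u + 1 with hc₁
  have hc₁1 : 1 ≤ c₁ := by rw [hc₁]; linarith [(Nat.cast_nonneg u : (0 : ℝ) ≤ u)]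
  -- Binary designs bound each linear predictor by (u + 1)‖β‖, so on the unit ball about `β₀` all
  -- predictors lie in one interval, whatever the grid.
  set L : ℝ := c₁ * (‖β₀‖ + 1) with hL
  obtain ⟨C₁, hC₁, b1, d1, l1, t1⟩ := exists_taylor_bound contDiff_logisticSD L
  obtain ⟨C₂, hC₂, b2, d2, l2, t2⟩ := exists_taylor_bound (contDiff_stdResidual 0) L
  obtain ⟨C₃, hC₃, b3, d3, l3, t3⟩ := exists_taylor_bound (contDiff_stdResidual 1) L
  set C₀ : ℝ := C₁ + C₂ + C₃ with hC₀
  have hC₀0 : 0 ≤ C₀ := by positivity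
  set C : ℝ := C₀ * c₁ ^ 2 with hC
  have hC0 : 0 ≤ C := by positivity
  refine ⟨c₁ * (4 * δ⁻¹ * C ^ 2), by positivity, ?_⟩
  intro m n T hT y hy t ht0 ht1 β hβ β' hβ'
  rw [mem_closedBall_iff_norm] at hβ hβ'
  set Q := (corrMatrix a ρ p m n)⁻¹ with hQ
  have hunit := isUnit_det_of_lower_bound hδ (hΓ m n)
  have hcard : (Fintype.card (Site m n) : ℝ) = ((m * n : ℕ) : ℝ) := by simp [Site]
  have hbil : ∀ (x y : Site m n → ℝ) (a b : ℝ), 0 ≤ a → 0 ≤ b → (∀ i, |x i| ≤ a) →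
      (∀ i, |y i| ≤ b) → |x ⬝ᵥ Q *ᵥ y| ≤ (δ⁻¹ * ((m * n : ℕ) : ℝ)) * a * b := by
    rw [← hcard]
    exact abs_dotProduct_inv_mulVec_le hδ (hΓ m n)
  have hetaI : ∀ γ : EuclideanSpace ℝ (Fin (u + 1)), ‖γ - β₀‖ ≤ t → ∀ s,
      eta T γ s ∈ Set.Icc (-L) L := by
    intro γ hγ s
    have h1 : ‖γ‖ ≤ ‖β₀‖ + 1 := by
      have := norm_le_norm_add_norm_sub' γ β₀
      linarith
    have h2 := (abs_eta_le γ hT s).trans (mul_le_mul_of_nonneg_left h1 (by positivity))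
    exact abs_le.1 h2
  have hetad : ∀ γ γ' : EuclideanSpace ℝ (Fin (u + 1)), ∀ s,
      |eta T γ s - eta T γ' s| ≤ c₁ * ‖γ - γ'‖ := by
    intro γ γ' s
    rw [← eta_sub]; exact abs_eta_le _ hT s
  have hβ₀ : ‖β₀ - β₀‖ ≤ t := by simpa using ht0
  set w : ℝ := ‖β - β'‖ with hw
  have hw0 : 0 ≤ w := norm_nonneg _
  have hscalar : ∀ f : ℝ → ℝ,
      ((∀ x ∈ Set.Icc (-L) L, |f x| ≤ C₀) ∧ (∀ x ∈ Set.Icc (-L) L, |deriv f x| ≤ C₀) ∧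
      (∀ x ∈ Set.Icc (-L) L, ∀ y ∈ Set.Icc (-L) L, |f x - f y| ≤ C₀ * |x - y|) ∧
      ∀ x ∈ Set.Icc (-L) L, ∀ y ∈ Set.Icc (-L) L, ∀ z ∈ Set.Icc (-L) L, ∀ h,
        |x - z| ≤ h → |y - z| ≤ h → |f x - f y - deriv f z * (x - y)| ≤ C₀ * h * |x - y|) →
      ∀ s, (∀ γ, ‖γ - β₀‖ ≤ t → |f (eta T γ s)| ≤ C) ∧
        |deriv f (eta T β₀ s) * eta T (β - β') s| ≤ C * w ∧
        (∀ γ, ‖γ - β₀‖ ≤ t → |f (eta T γ s) - f (eta T β₀ s)| ≤ C * t) ∧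
        |f (eta T β s) - f (eta T β' s) - deriv f (eta T β₀ s) * eta T (β - β') s| ≤ C * t * w := by
    intro f ⟨f1, f2, f3, f4⟩ s
    have hsq : c₁ ≤ c₁ ^ 2 := by nlinarith
    have hCle : C₀ ≤ C := by rw [hC]; nlinarith
    have hCle1 : C₀ * c₁ ≤ C := by rw [hC]; exact mul_le_mul_of_nonneg_left hsq hC₀0
    refine ⟨fun γ hγ => (f1 _ (hetaI γ hγ s)).trans hCle, ?_, fun γ hγ => ?_, ?_⟩
    · rw [abs_mul, eta_sub]
      calc _ ≤ C₀ * (c₁ * w) := mul_le_mul (f2 _ (hetaI β₀ hβ₀ s)) (hetad β β' s)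
            (abs_nonneg _) hC₀0
        _ = (C₀ * c₁) * w := by ring
        _ ≤ _ := mul_le_mul_of_nonneg_right hCle1 hw0
    · calc _ ≤ C₀ * |eta T γ s - eta T β₀ s| := f3 _ (hetaI γ hγ s) _ (hetaI β₀ hβ₀ s)
        _ ≤ C₀ * (c₁ * t) := mul_le_mul_of_nonneg_left ((hetad γ β₀ s).trans
            (mul_le_mul_of_nonneg_left hγ (by positivity))) hC₀0
        _ = (C₀ * c₁) * t := by ring
        _ ≤ _ := mul_le_mul_of_nonneg_right hCle1 ht0
    · rw [eta_sub]
      calc _ ≤ C₀ * (c₁ * t) * |eta T β s - eta T β' s| :=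
            f4 _ (hetaI β hβ s) _ (hetaI β' hβ' s) _ (hetaI β₀ hβ₀ s) _
              ((hetad β β₀ s).trans (mul_le_mul_of_nonneg_left hβ (by positivity)))
              ((hetad β' β₀ s).trans (mul_le_mul_of_nonneg_left hβ' (by positivity)))
        _ ≤ C₀ * (c₁ * t) * (c₁ * w) := mul_le_mul_of_nonneg_left (hetad β β' s) (by positivity)
        _ = _ := by rw [hC]; ring
  have hsd := hscalar logisticSD ⟨fun x hx => (b1 x hx).trans (by linarith),
    fun x hx => (d1 x hx).trans (by linarith),
    fun x hx y hy => (l1 x hx y hy).trans (mul_le_mul_of_nonneg_right (by linarith) (abs_nonneg _)),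
    fun x hx y hy z hz h hxz hyz => (t1 x hx y hy z hz h hxz hyz).trans
      (mul_le_mul_of_nonneg_right (mul_le_mul_of_nonneg_right (by linarith)
        ((abs_nonneg _).trans hxz)) (abs_nonneg _))⟩
  have hres : ∀ s, _ := fun s => hscalar (stdResidual (y s)) (by
    rcases hy s with h | h
    · rw [h]
      exact ⟨fun x hx => (b2 x hx).trans (by linarith),
        fun x hx => (d2 x hx).trans (by linarith),
        fun x hx y hy => (l2 x hx y hy).trans
          (mul_le_mul_of_nonneg_right (by linarith) (abs_nonneg _)),
        fun x hx y hy z hz h hxz hyz => (t2 x hx y hy z hz h hxz hyz).trans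
          (mul_le_mul_of_nonneg_right (mul_le_mul_of_nonneg_right (by linarith)
            ((abs_nonneg _).trans hxz)) (abs_nonneg _))⟩
    · rw [h]
      exact ⟨fun x hx => (b3 x hx).trans (by linarith),
        fun x hx => (d3 x hx).trans (by linarith),
        fun x hx y hy => (l3 x hx y hy).trans
          (mul_le_mul_of_nonneg_right (by linarith) (abs_nonneg _)),
        fun x hx y hy z hz h hxz hyz => (t3 x hx y hy z hz h hxz hyz).trans
          (mul_le_mul_of_nonneg_right (mul_le_mul_of_nonneg_right (by linarith)
            ((abs_nonneg _).trans hxz)) (abs_nonneg _))⟩) s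
  have hTmul : ∀ s j (x c : ℝ), |x| ≤ c → |T s j * x| ≤ c := by
    intro s j x c hx
    rw [abs_mul]
    calc _ ≤ 1 * c := mul_le_mul (abs_design_le hT s j) hx (abs_nonneg _) zero_le_one
      _ = c := one_mul _
  have hcomp : ∀ j, |(quasiScore T β a ρ p y - quasiScore T β' a ρ p y -
          Matrix.toEuclideanCLM (𝕜 := ℝ) (meanDeriv T β₀ Q
            + fluctDeriv T β₀ Q (residuals T β₀ y)) (β - β')) j|
      ≤ 4 * (δ⁻¹ * ((m * n : ℕ) : ℝ)) * C ^ 2 * t * w := by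
    intro j
    have e : (Matrix.toEuclideanCLM (𝕜 := ℝ) (meanDeriv T β₀ Q
            + fluctDeriv T β₀ Q (residuals T β₀ y)) (β - β')) j
        = ((meanDeriv T β₀ Q + fluctDeriv T β₀ Q (residuals T β₀ y)) *ᵥ (β - β').ofLp) j := rfl
    rw [PiLp.sub_apply, PiLp.sub_apply, e, deriv_mulVec_apply, quasiScore_apply T β hunit,
      quasiScore_apply T β' hunit]
    refine abs_bilinear_expansion_le hbil hC0 ht0 hw0 (fun s => ?_) (fun s => ?_) (fun s => ?_)
      (fun s => ?_) (fun s => ?_) (fun s => ?_) (fun s => ?_) (fun s => ?_)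
    · exact hTmul _ _ _ _ ((hsd s).1 β' hβ')
    · exact (hres s).1 β hβ
    · refine hTmul _ _ _ _ ?_
      have := (hsd s).2.1
      rwa [deriv_logisticSD] at this
    · have := (hres s).2.1
      rwa [deriv_stdResidual (hy s)] at this
    · rw [scaledDesign, scaledDesign, ← mul_sub]
      exact hTmul _ _ _ _ ((hsd s).2.2.1 β' hβ')
    · exact (hres s).2.2.1 β hβ
    · rw [scaledDesign, scaledDesign, ← mul_sub, ← mul_sub]
      refine hTmul _ _ _ _ ?_
      have := (hsd s).2.2.2
      rwa [deriv_logisticSD] at this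
    · have := (hres s).2.2.2
      rwa [deriv_stdResidual (hy s)] at this
  refine (euclidean_norm_le_of_abs_le _ (by positivity) hcomp).trans_eq ?_
  rw [hc₁]
  push_cast
  ring

/-! ### Second moments at the true parameter -/

section Moments

variable {Ω : Type*} [MeasurableSpace Ω] {μ : Measure Ω}

section LinearForms

variable {ι : Type*} [Fintype ι] {Z : ι → Ω → ℝ}

theorem integrable_dotProduct (hint : ∀ i, Integrable (Z i) μ) (w : ι → ℝ) :
    Integrable (fun ω => w ⬝ᵥ fun i => Z i ω) μ := by
  simp only [dotProduct]
  exact integrable_finsetSum _ fun i _ => (hint i).const_mul (w i)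

theorem integral_dotProduct_eq_zero (hint : ∀ i, Integrable (Z i) μ)
    (hmean : ∀ i, ∫ ω, Z i ω ∂μ = 0) (w : ι → ℝ) :
    ∫ ω, (w ⬝ᵥ fun i => Z i ω) ∂μ = 0 := by
  simp only [dotProduct]
  rw [integral_finsetSum _ fun i _ => (hint i).const_mul (w i)]
  simp [integral_const_mul, hmean]

theorem sq_dotProduct (w z : ι → ℝ) :
    (w ⬝ᵥ z) ^ 2 = ∑ i, ∑ j, w i * w j * (z i * z j) := by
  rw [sq, dotProduct, Finset.sum_mul_sum]
  exact Finset.sum_congr rfl fun i _ => Finset.sum_congr rfl fun j _ => by ring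

theorem integrable_sq_dotProduct (hint : ∀ i j, Integrable (fun ω => Z i ω * Z j ω) μ)
    (w : ι → ℝ) : Integrable (fun ω => (w ⬝ᵥ fun i => Z i ω) ^ 2) μ := by
  simp only [sq_dotProduct]
  exact integrable_finsetSum _ fun i _ => integrable_finsetSum _ fun j _ =>
    (hint i j).const_mul _

theorem integral_sq_dotProduct (hint : ∀ i j, Integrable (fun ω => Z i ω * Z j ω) μ)
    (w : ι → ℝ) : ∫ ω, (w ⬝ᵥ fun i => Z i ω) ^ 2 ∂μ
      = ∑ i, ∑ j, w i * w j * ∫ ω, Z i ω * Z j ω ∂μ := by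
  simp only [sq_dotProduct]
  rw [integral_finsetSum _ fun i _ => integrable_finsetSum _ fun j _ =>
    (hint i j).const_mul _]
  refine Finset.sum_congr rfl fun i _ => ?_
  rw [integral_finsetSum _ fun j _ => (hint i j).const_mul _]
  simp only [integral_const_mul]

end LinearForms

variable [IsProbabilityMeasure μ] {m n u : ℕ} {T : Matrix (Site m n) (Fin (u + 1)) ℝ}
  {β₀ : EuclideanSpace ℝ (Fin (u + 1))} {a ρ p : ℝ} {Y : Site m n → Ω → ℝ}

theorem measurable_residuals (hYmeas : ∀ s, Measurable (Y s)) (s : Site m n) :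
    Measurable fun ω => residuals T β₀ (fun s => Y s ω) s := by
  have := hYmeas s
  unfold residuals stdResidual
  fun_prop

theorem abs_residuals_le {Ω : Type*} {Y : Site m n → Ω → ℝ}
    (hYbin : ∀ s ω, Y s ω = 0 ∨ Y s ω = 1) (s : Site m n) (ω : Ω) :
    |residuals T β₀ (fun s => Y s ω) s|
      ≤ Real.exp (eta T β₀ s / 2) + Real.exp (-(eta T β₀ s / 2)) := by
  have h1 := Real.exp_pos (eta T β₀ s / 2)
  have h2 := Real.exp_pos (-(eta T β₀ s / 2))
  simp only [residuals, stdResidual]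
  rcases hYbin s ω with h | h <;> rw [h, abs_le] <;> constructor <;> linarith

theorem integrable_residuals (hYmeas : ∀ s, Measurable (Y s))
    (hYbin : ∀ s ω, Y s ω = 0 ∨ Y s ω = 1) (s : Site m n) :
    Integrable (fun ω => residuals T β₀ (fun s => Y s ω) s) μ :=
  Integrable.of_bound (measurable_residuals hYmeas s).aestronglyMeasurable _
    (Eventually.of_forall fun ω => abs_residuals_le hYbin s ω)

theorem integrable_residuals_mul (hYmeas : ∀ s, Measurable (Y s))
    (hYbin : ∀ s ω, Y s ω = 0 ∨ Y s ω = 1) (s s' : Site m n) :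
    Integrable (fun ω => residuals T β₀ (fun s => Y s ω) s
      * residuals T β₀ (fun s => Y s ω) s') μ := by
  refine Integrable.of_bound
    ((measurable_residuals hYmeas s).mul (measurable_residuals hYmeas s')).aestronglyMeasurable
    ((Real.exp (eta T β₀ s / 2) + Real.exp (-(eta T β₀ s / 2)))
      * (Real.exp (eta T β₀ s' / 2) + Real.exp (-(eta T β₀ s' / 2))))
    (Eventually.of_forall fun ω => ?_)
  rw [norm_mul]
  exact mul_le_mul (abs_residuals_le hYbin s ω) (abs_residuals_le hYbin s' ω) (norm_nonneg _)
    (by positivity)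

theorem integrable_of_binary (hYmeas : ∀ s, Measurable (Y s))
    (hYbin : ∀ s ω, Y s ω = 0 ∨ Y s ω = 1) (s : Site m n) : Integrable (Y s) μ :=
  Integrable.of_bound (hYmeas s).aestronglyMeasurable 1
    (Eventually.of_forall fun ω => by rcases hYbin s ω with h | h <;> simp [h])

theorem integral_residuals (hYmeas : ∀ s, Measurable (Y s))
    (hYbin : ∀ s ω, Y s ω = 0 ∨ Y s ω = 1) (hYmean : ∀ s, ∫ ω, Y s ω ∂μ = theta T β₀ s)
    (s : Site m n) : ∫ ω, residuals T β₀ (fun s => Y s ω) s ∂μ = 0 := by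
  have h0 := (logisticSD_pos (eta T β₀ s)).ne'
  have h1 : ∫ ω, logisticSD (eta T β₀ s) * residuals T β₀ (fun s => Y s ω) s ∂μ = 0 := by
    simp only [residuals, logisticSD_mul_stdResidual]
    rw [integral_sub (integrable_of_binary hYmeas hYbin s) (integrable_const _), hYmean,
      theta_eq_logistic]
    simp
  rw [integral_const_mul] at h1
  exact (mul_eq_zero.1 h1).resolve_left h0

theorem variance_of_binary (hYmeas : ∀ s, Measurable (Y s))
    (hYbin : ∀ s ω, Y s ω = 0 ∨ Y s ω = 1) (hYmean : ∀ s, ∫ ω, Y s ω ∂μ = theta T β₀ s)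
    (s : Site m n) : Var[Y s; μ] = logisticSD (eta T β₀ s) ^ 2 := by
  rw [variance_eq_integral (hYmeas s).aemeasurable, hYmean, logisticSD_sq, ← theta_eq_logistic]
  have : ∀ ω, (Y s ω - theta T β₀ s) ^ 2
      = (1 - 2 * theta T β₀ s) * Y s ω + theta T β₀ s ^ 2 := by
    intro ω
    rcases hYbin s ω with h | h <;> rw [h] <;> ring
  simp only [this]
  rw [integral_add ((integrable_of_binary hYmeas hYbin s).const_mul _) (integrable_const _),
    integral_const_mul, hYmean]
  simp
  ring

/-- The standardised residuals have covariance matrix `Γ`. -/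
theorem integral_residuals_mul (hYmeas : ∀ s, Measurable (Y s))
    (hYbin : ∀ s ω, Y s ω = 0 ∨ Y s ω = 1) (hYmean : ∀ s, ∫ ω, Y s ω ∂μ = theta T β₀ s)
    (hcorr : ∀ s s', s ≠ s' → corr (Y s) (Y s') μ = a * ρ ^ lpDist p s s') (s s' : Site m n) :
    ∫ ω, residuals T β₀ (fun s => Y s ω) s * residuals T β₀ (fun s => Y s ω) s' ∂μ
      = corrMatrix a ρ p m n s s' := by
  set σ := logisticSD (eta T β₀ s) with hσ
  set σ' := logisticSD (eta T β₀ s') with hσ'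
  have hσ0 : 0 < σ := logisticSD_pos _
  have hσ0' : 0 < σ' := logisticSD_pos _
  have h1 : cov[Y s, Y s'; μ] = σ * σ' *
      ∫ ω, residuals T β₀ (fun s => Y s ω) s * residuals T β₀ (fun s => Y s ω) s' ∂μ := by
    rw [covariance, ← integral_const_mul, hYmean, hYmean]
    congr 1
    ext ω
    rw [theta_eq_logistic, theta_eq_logistic, ← logisticSD_mul_stdResidual,
      ← logisticSD_mul_stdResidual]
    simp only [residuals]
    ring
  have hσσ : σ * σ' ≠ 0 := (mul_pos hσ0 hσ0').ne'
  have hv := variance_of_binary hYmeas hYbin hYmean s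
  have hv' := variance_of_binary hYmeas hYbin hYmean s'
  by_cases hs : s = s'
  · subst hs
    rw [covariance_self (hYmeas s).aemeasurable, hv] at h1
    have : corrMatrix a ρ p m n s s = 1 := by simp [corrMatrix]
    rw [this]
    refine mul_left_cancel₀ hσσ ?_
    rw [← h1, ← hσ]; ring
  · have h2 := hcorr s s' hs
    rw [corr, hv, hv', Real.sqrt_sq hσ0.le, Real.sqrt_sq hσ0'.le, h1,
      mul_div_cancel_left₀ _ hσσ] at h2
    rw [h2]
    simp [corrMatrix, hs]

/-- Domination by the Frobenius norm reduces the random operator to finitely many squared linear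
forms in the residuals. -/
theorem toEuclideanCLM_norm_sq_le {k : ℕ} (A : Matrix (Fin k) (Fin k) ℝ) :
    ‖Matrix.toEuclideanCLM (𝕜 := ℝ) A‖ ^ 2 ≤ ∑ i, ∑ j, A i j ^ 2 := by
  have h0 : 0 ≤ ∑ i, ∑ j, A i j ^ 2 :=
    Finset.sum_nonneg fun _ _ => Finset.sum_nonneg fun _ _ => sq_nonneg _
  have : ‖Matrix.toEuclideanCLM (𝕜 := ℝ) A‖ ≤ Real.sqrt (∑ i, ∑ j, A i j ^ 2) := by
    refine ContinuousLinearMap.opNorm_le_bound _ (Real.sqrt_nonneg _) fun v => ?_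
    refine abs_le_of_sq_le_sq' ?_ (by positivity) |>.2
    rw [mul_pow, Real.sq_sqrt h0, EuclideanSpace.norm_sq_eq, EuclideanSpace.norm_sq_eq,
      Finset.sum_mul]
    refine Finset.sum_le_sum fun i _ => ?_
    have := Finset.sum_mul_sq_le_sq_mul_sq Finset.univ (A i) v
    simp only [Real.norm_eq_abs, sq_abs]
    exact this
  calc _ ≤ Real.sqrt (∑ i, ∑ j, A i j ^ 2) ^ 2 := pow_le_pow_left₀ (norm_nonneg _) this 2
    _ = _ := Real.sq_sqrt h0

theorem corrMatrix_inv_transpose (a ρ p : ℝ) (m n : ℕ) :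
    ((corrMatrix a ρ p m n)⁻¹)ᵀ = (corrMatrix a ρ p m n)⁻¹ := by
  rw [Matrix.transpose_nonsing_inv]
  congr 1
  ext s s'
  exact corrMatrix_comm a ρ p s' s

theorem dotProduct_corrMatrix_inv_mulVec (x z : Site m n → ℝ) :
    x ⬝ᵥ (corrMatrix a ρ p m n)⁻¹ *ᵥ z = ((corrMatrix a ρ p m n)⁻¹ *ᵥ x) ⬝ᵥ z := by
  rw [Matrix.dotProduct_mulVec, ← Matrix.mulVec_transpose, corrMatrix_inv_transpose]

/-- Weights of the linear form `fluctDeriv T β Q z j k` in the residuals. -/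
noncomputable def fluctWeight (T : Matrix (Site m n) (Fin (u + 1)) ℝ)
    (β : EuclideanSpace ℝ (Fin (u + 1))) (Q : Matrix (Site m n) (Site m n) ℝ) (j k : Fin (u + 1))
    (s : Site m n) : ℝ :=
  -(Q *ᵥ fun s => skew T β s * scaledDesign T β j s * T s k) s
    + (Q *ᵥ scaledDesign T β j) s * (skew T β s * T s k)

theorem fluctDeriv_eq_dotProduct (z : Site m n → ℝ) (j k : Fin (u + 1)) :
    fluctDeriv T β₀ (corrMatrix a ρ p m n)⁻¹ z j k
      = fluctWeight T β₀ (corrMatrix a ρ p m n)⁻¹ j k ⬝ᵥ z := by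
  rw [fluctDeriv, Matrix.of_apply, dotProduct_corrMatrix_inv_mulVec,
    dotProduct_corrMatrix_inv_mulVec]
  simp only [dotProduct, fluctWeight]
  rw [← Finset.sum_neg_distrib, ← Finset.sum_add_distrib]
  exact Finset.sum_congr rfl fun s _ => by ring

theorem sum_sq_corrMatrix_inv_mulVec_le {δ : ℝ} (hδ : 0 < δ)
    (hΓ : ∀ x : Site m n → ℝ,
      δ * ∑ s, x s ^ 2 ≤ ∑ s, ∑ s', x s * x s' * corrMatrix a ρ p m n s s')
    (x : Site m n → ℝ) (hx : ∀ s, |x s| ≤ 1) :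
    ∑ s, ((corrMatrix a ρ p m n)⁻¹ *ᵥ x) s ^ 2 ≤ δ⁻¹ ^ 2 * ((m * n : ℕ) : ℝ) := by
  refine (sum_sq_inv_mulVec_le hδ hΓ x).trans (mul_le_mul_of_nonneg_left ?_ (by positivity))
  have : ∑ s, x s ^ 2 ≤ ∑ _s : Site m n, (1 : ℝ) := by
    refine Finset.sum_le_sum fun s _ => ?_
    rw [← sq_abs]
    exact pow_le_one₀ (abs_nonneg _) (hx s)
  simpa using this

theorem abs_scaledDesign_le (hT : IsBinaryDesign T) (j : Fin (u + 1)) (s : Site m n) :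
    |scaledDesign T β₀ j s| ≤ 1 := by
  rw [scaledDesign, abs_mul, abs_of_pos (logisticSD_pos _)]
  exact mul_le_one₀ (abs_design_le hT s j) (logisticSD_pos _).le (logisticSD_le_one _)

/-- Each of the two pieces of the weight is Γ⁻¹ applied to a vector with entries at most 1, up to a
further factor at most 1. The 4 comes from (x + y)² ≤ 2x² + 2y². -/
theorem sum_sq_fluctWeight_le (hT : IsBinaryDesign T) {δ : ℝ} (hδ : 0 < δ)
    (hΓ : ∀ x : Site m n → ℝ,
      δ * ∑ s, x s ^ 2 ≤ ∑ s, ∑ s', x s * x s' * corrMatrix a ρ p m n s s') (j k : Fin (u + 1)) :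
    ∑ s, fluctWeight T β₀ (corrMatrix a ρ p m n)⁻¹ j k s ^ 2
      ≤ 4 * (δ⁻¹ ^ 2 * ((m * n : ℕ) : ℝ)) := by
  have hsk : ∀ s, |skew T β₀ s * T s k| ≤ 1 := by
    intro s
    rw [abs_mul]
    exact mul_le_one₀ (abs_logistic_sub_half_le _) (abs_nonneg _) (abs_design_le hT s k)
  have h1 := sum_sq_corrMatrix_inv_mulVec_le hδ hΓ
    (fun s => skew T β₀ s * scaledDesign T β₀ j s * T s k) (fun s => by
      have : skew T β₀ s * scaledDesign T β₀ j s * T s k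
          = skew T β₀ s * T s k * scaledDesign T β₀ j s := by ring
      rw [this, abs_mul]
      exact mul_le_one₀ (hsk s) (abs_nonneg _) (abs_scaledDesign_le hT j s))
  have h2 := sum_sq_corrMatrix_inv_mulVec_le hδ hΓ (scaledDesign T β₀ j) (abs_scaledDesign_le hT j)
  have h3 : ∑ s, fluctWeight T β₀ (corrMatrix a ρ p m n)⁻¹ j k s ^ 2 ≤
      ∑ s, (2 * ((corrMatrix a ρ p m n)⁻¹ *ᵥ fun s =>
          skew T β₀ s * scaledDesign T β₀ j s * T s k) s ^ 2
        + 2 * ((corrMatrix a ρ p m n)⁻¹ *ᵥ scaledDesign T β₀ j) s ^ 2) := by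
    refine Finset.sum_le_sum fun s _ => ?_
    set A := ((corrMatrix a ρ p m n)⁻¹ *ᵥ fun s => skew T β₀ s * scaledDesign T β₀ j s * T s k) s
      with hA
    set B := ((corrMatrix a ρ p m n)⁻¹ *ᵥ scaledDesign T β₀ j) s with hB
    have e : fluctWeight T β₀ (corrMatrix a ρ p m n)⁻¹ j k s = -A + B * (skew T β₀ s * T s k) := rfl
    rw [e]
    have h4 : (B * (skew T β₀ s * T s k)) ^ 2 ≤ B ^ 2 := by
      rw [mul_pow]
      refine mul_le_of_le_one_right (sq_nonneg _) ?_
      rw [← sq_abs]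
      exact pow_le_one₀ (abs_nonneg _) (hsk s)
    nlinarith [sq_nonneg (A + B * (skew T β₀ s * T s k))]
  rw [Finset.sum_add_distrib, ← Finset.mul_sum, ← Finset.mul_sum] at h3
  linarith

/-- At the true parameter the quasi-score is centred, and the second moments of the quasi-score and
of its centred derivative are of order `N`. -/
theorem exists_quasiScore_moment_bound (hT : IsBinaryDesign T) {δ C : ℝ} (hδ : 0 < δ)
    (hΓ : ∀ x : Site m n → ℝ,
      δ * ∑ s, x s ^ 2 ≤ ∑ s, ∑ s', x s * x s' * corrMatrix a ρ p m n s s') (hC : 0 ≤ C)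
    (hΓ' : ∀ x : Site m n → ℝ,
      ∑ s, ∑ s', x s * x s' * corrMatrix a ρ p m n s s' ≤ C * ∑ s, x s ^ 2)
    (hYmeas : ∀ s, Measurable (Y s))
    (hYbin : ∀ s ω, Y s ω = 0 ∨ Y s ω = 1) (hYmean : ∀ s, ∫ ω, Y s ω ∂μ = theta T β₀ s)
    (hcorr : ∀ s s', s ≠ s' → corr (Y s) (Y s') μ = a * ρ ^ lpDist p s s') :
    Integrable (fun ω => quasiScore T β₀ a ρ p fun s => Y s ω) μ ∧
    ∫ ω, quasiScore T β₀ a ρ p (fun s => Y s ω) ∂μ = 0 ∧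
    ∃ S : Ω → ℝ, Integrable S μ ∧
      (∀ ω, ‖Matrix.toEuclideanCLM (𝕜 := ℝ) (fluctDeriv T β₀ (corrMatrix a ρ p m n)⁻¹
          (residuals T β₀ fun s => Y s ω))‖ ^ 2
        + ‖quasiScore T β₀ a ρ p fun s => Y s ω‖ ^ 2 ≤ S ω) ∧
      ∫ ω, S ω ∂μ ≤ 5 * C * δ⁻¹ ^ 2 * (u + 1) ^ 2 * ((m * n : ℕ) : ℝ) := by
  set Q := (corrMatrix a ρ p m n)⁻¹ with hQ
  set Z : Site m n → Ω → ℝ := fun s ω => residuals T β₀ (fun s => Y s ω) s with hZ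
  have hunit := isUnit_det_of_lower_bound hδ hΓ
  have hscore : ∀ ω j, quasiScore T β₀ a ρ p (fun s => Y s ω) j
      = (Q *ᵥ scaledDesign T β₀ j) ⬝ᵥ fun s => Z s ω := by
    intro ω j
    rw [quasiScore_apply T β₀ hunit, dotProduct_corrMatrix_inv_mulVec]
  have hZint : ∀ s, Integrable (Z s) μ := integrable_residuals hYmeas hYbin
  have hZZ : ∀ s s', Integrable (fun ω => Z s ω * Z s' ω) μ :=
    integrable_residuals_mul hYmeas hYbin
  have hZ0 : ∀ s, ∫ ω, Z s ω ∂μ = 0 := integral_residuals hYmeas hYbin hYmean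
  -- The residuals have covariance Γ, so this second moment is exactly the quadratic form wᵀΓw.
  have hvar : ∀ w : Site m n → ℝ, ∫ ω, (w ⬝ᵥ fun s => Z s ω) ^ 2 ∂μ ≤ C * ∑ s, w s ^ 2 := by
    intro w
    rw [integral_sq_dotProduct hZZ]
    refine le_trans (le_of_eq ?_) (hΓ' w)
    refine Finset.sum_congr rfl fun s _ => Finset.sum_congr rfl fun s' _ => ?_
    rw [← integral_residuals_mul hYmeas hYbin hYmean hcorr s s']
  have hint : Integrable (fun ω => quasiScore T β₀ a ρ p fun s => Y s ω) μ := by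
    refine (PiLp.continuousLinearEquiv 2 ℝ fun _ : Fin (u + 1) => ℝ).integrable_comp_iff.1 ?_
    refine Integrable.of_eval fun j => ?_
    refine (integrable_dotProduct hZint (Q *ᵥ scaledDesign T β₀ j)).congr
      (Eventually.of_forall fun ω => ?_)
    exact (hscore ω j).symm
  refine ⟨hint, ?_, fun ω => (∑ j, ∑ k, (fluctWeight T β₀ Q j k ⬝ᵥ fun s => Z s ω) ^ 2)
    + ∑ j, ((Q *ᵥ scaledDesign T β₀ j) ⬝ᵥ fun s => Z s ω) ^ 2, ?_, ?_, ?_⟩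
  · ext j
    have h1 := (EuclideanSpace.proj (𝕜 := ℝ) j : EuclideanSpace ℝ (Fin (u + 1)) →L[ℝ] ℝ).integral_comp_comm hint
    have h2 := integral_dotProduct_eq_zero hZint hZ0 (Q *ᵥ scaledDesign T β₀ j)
    simp only [← hscore] at h2
    exact h1.symm.trans h2
  · refine Integrable.add ?_ ?_
    · exact integrable_finsetSum _ fun j _ => integrable_finsetSum _ fun k _ =>
        integrable_sq_dotProduct hZZ _
    · exact integrable_finsetSum _ fun j _ => integrable_sq_dotProduct hZZ _
  · intro ω
    refine add_le_add ((toEuclideanCLM_norm_sq_le _).trans (le_of_eq ?_)) (le_of_eq ?_)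
    · refine Finset.sum_congr rfl fun j _ => Finset.sum_congr rfl fun k _ => ?_
      rw [fluctDeriv_eq_dotProduct]
    · rw [EuclideanSpace.norm_sq_eq]
      refine Finset.sum_congr rfl fun j _ => ?_
      rw [hscore, Real.norm_eq_abs, sq_abs]
  · rw [integral_add (integrable_finsetSum _ fun j _ => integrable_finsetSum _ fun k _ =>
        integrable_sq_dotProduct hZZ _)
      (integrable_finsetSum _ fun j _ => integrable_sq_dotProduct hZZ _),
      integral_finsetSum _ fun j _ => integrable_finsetSum _ fun k _ =>
        integrable_sq_dotProduct hZZ _,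
      integral_finsetSum _ fun j _ => integrable_sq_dotProduct hZZ _]
    set B := δ⁻¹ ^ 2 * ((m * n : ℕ) : ℝ) with hB
    have hB0 : 0 ≤ B := by positivity
    have h1 : ∑ j, ∫ ω, ∑ k, (fluctWeight T β₀ Q j k ⬝ᵥ fun s => Z s ω) ^ 2 ∂μ
        ≤ ∑ _j : Fin (u + 1), ∑ _k : Fin (u + 1), C * (4 * B) := by
      refine Finset.sum_le_sum fun j _ => ?_
      rw [integral_finsetSum _ fun k _ => integrable_sq_dotProduct hZZ _]
      exact Finset.sum_le_sum fun k _ => (hvar _).trans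
        (mul_le_mul_of_nonneg_left (sum_sq_fluctWeight_le hT hδ hΓ j k) hC)
    have h2 : ∑ j, ∫ ω, ((Q *ᵥ scaledDesign T β₀ j) ⬝ᵥ fun s => Z s ω) ^ 2 ∂μ
        ≤ ∑ _j : Fin (u + 1), C * B :=
      Finset.sum_le_sum fun j _ => (hvar _).trans (mul_le_mul_of_nonneg_left
        (sum_sq_corrMatrix_inv_mulVec_le hδ hΓ _ (abs_scaledDesign_le hT j)) hC)
    simp only [Finset.sum_const, Finset.card_univ, Fintype.card_fin, nsmul_eq_mul] at h1 h2
    push_cast at h1 h2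
    have h3 : ((u : ℝ) + 1) * (C * B) ≤ ((u : ℝ) + 1) ^ 2 * (C * B) := by
      refine mul_le_mul_of_nonneg_right ?_ (by positivity)
      nlinarith [(Nat.cast_nonneg u : (0 : ℝ) ≤ u)]
    -- The constant 5 is 4 from the (u + 1)² derivative entries plus 1 from the score, whose u + 1
    -- components are counted as (u + 1)².
    calc _ ≤ ((u : ℝ) + 1) * (((u : ℝ) + 1) * (C * (4 * B))) + ((u : ℝ) + 1) * (C * B) :=
          add_le_add h1 h2
      _ ≤ 5 * (((u : ℝ) + 1) ^ 2 * (C * B)) := by linarith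
      _ = _ := by rw [hB]; ring

end Moments

/-! ### From pointwise expansion to bias -/

theorem hasFDerivAt_of_norm_sub_le {E F : Type*} [NormedAddCommGroup E] [NormedSpace ℝ E]
    [NormedAddCommGroup F] [NormedSpace ℝ F] {f : E → F} {f' : E →L[ℝ] F} {x : E} {K : ℝ}
    (h : ∀ t, 0 ≤ t → t ≤ 1 → ∀ y ∈ Metric.closedBall x t, ∀ y' ∈ Metric.closedBall x t,
      ‖f y - f y' - f' (y - y')‖ ≤ K * t * ‖y - y'‖) : HasFDerivAt f f' x := by
  refine .of_isLittleO (Asymptotics.isLittleO_iff.2 fun ε hε => ?_)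
  have hr : 0 < min 1 (ε / (|K| + 1)) := by positivity
  filter_upwards [Metric.ball_mem_nhds x hr] with y hy
  rw [mem_ball_iff_norm] at hy
  have h1 := h ‖y - x‖ (norm_nonneg _) (hy.le.trans (min_le_left _ _)) y
    (by rw [mem_closedBall_iff_norm]) x (Metric.mem_closedBall_self (norm_nonneg _))
  refine h1.trans (mul_le_mul_of_nonneg_right ?_ (norm_nonneg _))
  have h2 : ‖y - x‖ ≤ ε / (|K| + 1) := hy.le.trans (min_le_right _ _)
  rw [le_div_iff₀ (by positivity)] at h2
  have h3 := mul_le_mul_of_nonneg_right (le_abs_self K) (norm_nonneg (y - x))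
  nlinarith [norm_nonneg (y - x)]

/-- If a random vector differs from a centred one by at most `S`, its mean is at most that of
`S`. -/
theorem norm_integral_le_of_norm_add_le {Ω E : Type*} [MeasurableSpace Ω] {μ : Measure Ω}
    [NormedAddCommGroup E] [NormedSpace ℝ E] {X g : Ω → E} {S : Ω → ℝ} (hX : Integrable X μ)
    (hg : Integrable g μ) (hg0 : ∫ ω, g ω ∂μ = 0) (hS : Integrable S μ)
    (h : ∀ᵐ ω ∂μ, ‖X ω + g ω‖ ≤ S ω) : ‖∫ ω, X ω ∂μ‖ ≤ ∫ ω, S ω ∂μ := by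
  have h1 : ∫ ω, X ω ∂μ = ∫ ω, (X ω + g ω) ∂μ := by rw [integral_add hX hg, hg0, add_zero]
  rw [h1]
  exact norm_integral_le_of_norm_le hS h

/-- Two events, one of probability more than one half and one with a complement of probability less
than one half, meet. -/
theorem exists_mem_of_measure_gt_half {Ω : Type*} [MeasurableSpace Ω] {μ : Measure Ω} {A B : Set Ω}
    (hA : 1 / 2 < μ A) (hB : μ Bᶜ < 1 / 2) : ∃ ω, ω ∈ A ∧ ω ∈ B := by
  -- Only monotonicity of the measure is used, so neither event has to be measurable.
  by_contra! h
  exact absurd (measure_mono (μ := μ) (fun ω hω => h ω hω : A ⊆ Bᶜ)) (not_le.2 (hB.trans hA))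

end BinarySpatial

theorem corollary2p1 {u : ℕ} (β₀ : EuclideanSpace ℝ (Fin (u + 1)))
    (a ρ p : ℝ) (ha0 : 0 < a) (ha1 : a ≤ 1) (hρ0 : 0 ≤ ρ) (hρ1 : ρ < 1) (hp : 1 ≤ p)
    -- a sequence of grids, of sizes `N = m n → ∞`
    (m n : ℕ → ℕ) (hN : Tendsto (fun ν => m ν * n ν) atTop atTop)
    (T : ∀ ν, Matrix (BinarySpatial.Site (m ν) (n ν)) (Fin (u + 1)) ℝ)
    (hT : ∀ ν, BinarySpatial.IsBinaryDesign (T ν))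
    (Ω : ℕ → Type*) [∀ ν, MeasurableSpace (Ω ν)]
    (μ : ∀ ν, Measure (Ω ν)) [∀ ν, IsProbabilityMeasure (μ ν)]
    -- binary responses with logistic marginal means
    (Y : ∀ ν, BinarySpatial.Site (m ν) (n ν) → Ω ν → ℝ)
    (hYmeas : ∀ ν s, Measurable (Y ν s))
    (hYbin : ∀ ν s ω, Y ν s ω = 0 ∨ Y ν s ω = 1)
    (hYmean : ∀ ν s, ∫ ω, Y ν s ω ∂(μ ν) = BinarySpatial.theta (T ν) β₀ s)
    -- exponentially decreasing correlations
    (hcorr : ∀ ν s s', s ≠ s' →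
      BinarySpatial.corr (Y ν s) (Y ν s') (μ ν) = a * ρ ^ BinarySpatial.lpDist p s s')
    -- control of the higher order cumulants of the centred responses
    (hcum : ∀ k : ℕ, 3 ≤ k → ∃ α : ℝ, α < (k : ℝ) / 2 ∧
      (fun ν => BinarySpatial.cumulantSum (μ ν)
          (fun s ω => Y ν s ω - BinarySpatial.theta (T ν) β₀ s) k)
        =O[atTop] fun ν => ((m ν * n ν : ℕ) : ℝ) ^ α)
    -- `N⁻¹ D_β U(β₀)` is negative definite, uniformly in `N`, with probability tending to one
    (hneg : ∃ c : ℝ, 0 < c ∧ Tendsto (fun ν => μ ν {ω | ∀ v : EuclideanSpace ℝ (Fin (u + 1)),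
        1 / ((m ν * n ν : ℕ) : ℝ) * inner ℝ v (fderiv ℝ
          (fun β => BinarySpatial.quasiScore (T ν) β a ρ p (fun s => Y ν s ω)) β₀ v)
            ≤ -c * ‖v‖ ^ 2}) atTop (𝓝 1)) :
    ∃ r₀ : ℝ, 0 < r₀ ∧ ∀ r : ℝ, 0 < r → r ≤ r₀ →
      ∀ b : ∀ ν, Ω ν → EuclideanSpace ℝ (Fin (u + 1)),
        (∀ ν, BinarySpatial.IsQLEstimate (μ ν) (T ν) a ρ p (Y ν) β₀ r (b ν)) →
        (∃ R : ℝ, ∀ ν, ∀ᵐ ω ∂(μ ν), ‖b ν ω‖ ≤ R) →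
        (∀ ν, Integrable (b ν) (μ ν)) ∧
          (fun ν => ∫ ω, (b ν ω - β₀) ∂(μ ν)) =O[atTop] fun ν => 1 / ((m ν * n ν : ℕ) : ℝ) := by
  open BinarySpatial in
  obtain ⟨c, hc, hneg⟩ := hneg
  obtain ⟨δ, hδ, hlow⟩ := exists_corrMatrix_lower_bound ha0 ha1 hρ0 hρ1 hp
  obtain ⟨CΓ, hCΓ, hupp⟩ := exists_corrMatrix_upper_bound ha0 ha1 hρ0 hρ1 hp
  obtain ⟨K, hK, hexp⟩ := exists_quasiScore_expansion β₀ hδ hlow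
  have hc2 : 0 < c / 2 := by positivity
  obtain ⟨r₀, hr₀, hroot⟩ := exists_root_expansion (E := EuclideanSpace ℝ (Fin (u + 1))) hc2 hK
  refine ⟨r₀, hr₀, fun r hr hrr b hb hbound => ?_⟩
  obtain ⟨R, hR⟩ := hbound
  have hbint : ∀ ν, Integrable (b ν) (μ ν) := fun ν =>
    Integrable.of_bound (hb ν).1.aestronglyMeasurable R (hR ν)
  refine ⟨hbint, ?_⟩
  -- The argument bounds ‖b - β₀‖ by the triangle inequality.
  obtain ⟨C, hC, hpoint⟩ := hroot r hr hrr (R + ‖β₀‖)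
  set M : ℝ := 5 * CΓ * δ⁻¹ ^ 2 * (u + 1) ^ 2 with hM
  have hNreal : Tendsto (fun ν => ((m ν * n ν : ℕ) : ℝ)) atTop atTop :=
    tendsto_natCast_atTop_atTop.comp hN
  refine Asymptotics.IsBigO.of_bound (C * M) ?_
  have hhalf : ∀ᶠ ν in atTop, (1 / 2 : ENNReal) < μ ν {ω | ∀ v : EuclideanSpace ℝ (Fin (u + 1)),
        1 / ((m ν * n ν : ℕ) : ℝ) * inner ℝ v (fderiv ℝ
          (fun β => quasiScore (T ν) β a ρ p (fun s => Y ν s ω)) β₀ v) ≤ -c * ‖v‖ ^ 2} :=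
    hneg.eventually (lt_mem_nhds (by rw [one_div]; exact ENNReal.inv_lt_one.2 (by norm_num)))
  filter_upwards [hhalf, hNreal.eventually_gt_atTop 0,
    hNreal.eventually_gt_atTop (M / (c / 2) ^ 2 * 2)] with ν hνhalf hN0 hNlarge
  set N : ℝ := ((m ν * n ν : ℕ) : ℝ) with hNdef
  set Q := (corrMatrix a ρ p (m ν) (n ν))⁻¹ with hQ
  obtain ⟨hUint, hU0, S, hSint, hSle, hSmean⟩ := exists_quasiScore_moment_bound (hT ν) hδ
    (hlow (m ν) (n ν)) hCΓ.le (hupp (m ν) (n ν)) (hYmeas ν) (hYbin ν) (hYmean ν) (hcorr ν)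
  set D : EuclideanSpace ℝ (Fin (u + 1)) →L[ℝ] EuclideanSpace ℝ (Fin (u + 1)) :=
    N⁻¹ • Matrix.toEuclideanCLM (𝕜 := ℝ) (meanDeriv (T ν) β₀ Q) with hD
  set W : Ω ν → EuclideanSpace ℝ (Fin (u + 1)) →L[ℝ] EuclideanSpace ℝ (Fin (u + 1)) := fun ω =>
    N⁻¹ • Matrix.toEuclideanCLM (𝕜 := ℝ)
      (fluctDeriv (T ν) β₀ Q (residuals (T ν) β₀ fun s => Y ν s ω)) with hW
  have hexpω : ∀ ω t, 0 ≤ t → t ≤ 1 → ∀ β ∈ Metric.closedBall β₀ t,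
      ∀ β' ∈ Metric.closedBall β₀ t,
        ‖N⁻¹ • quasiScore (T ν) β a ρ p (fun s => Y ν s ω)
          - N⁻¹ • quasiScore (T ν) β' a ρ p (fun s => Y ν s ω) - (D + W ω) (β - β')‖
          ≤ K * t * ‖β - β'‖ := by
    intro ω t ht0 ht1 β hβ β' hβ'
    have h1 := hexp (m ν) (n ν) (T ν) (hT ν) (fun s => Y ν s ω) (fun s => hYbin ν s ω) t ht0 ht1
      β hβ β' hβ'
    have h2 : D + W ω = N⁻¹ • Matrix.toEuclideanCLM (𝕜 := ℝ) (meanDeriv (T ν) β₀ Q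
        + fluctDeriv (T ν) β₀ Q (residuals (T ν) β₀ fun s => Y ν s ω)) := by
      rw [hD, hW, map_add, smul_add]
    rw [h2, _root_.smul_apply, ← smul_sub, ← smul_sub, norm_smul, norm_inv,
      Real.norm_of_nonneg hN0.le, inv_mul_le_iff₀ hN0]
    refine h1.trans_eq ?_
    ring
  have hSW : ∀ ω, ‖W ω‖ ^ 2 + ‖N⁻¹ • quasiScore (T ν) β₀ a ρ p fun s => Y ν s ω‖ ^ 2
      ≤ N⁻¹ ^ 2 * S ω := by
    intro ω
    rw [hW, norm_smul, norm_smul, mul_pow, mul_pow, ← mul_add, norm_inv,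
      Real.norm_of_nonneg hN0.le]
    exact mul_le_mul_of_nonneg_left (hSle ω) (by positivity)
  have hfderiv : ∀ ω v, 1 / N * inner ℝ v (fderiv ℝ
      (fun β => quasiScore (T ν) β a ρ p (fun s => Y ν s ω)) β₀ v) = inner ℝ v ((D + W ω) v) := by
    intro ω v
    -- The uniform expansion also identifies the Fréchet derivative at `β₀`, tying the assumed
    -- negative definiteness to D + W.
    have h1 := (hasFDerivAt_of_norm_sub_le (hexpω ω)).const_smul N
    have h2 : (fun β => quasiScore (T ν) β a ρ p (fun s => Y ν s ω))
        = N • fun β => N⁻¹ • quasiScore (T ν) β a ρ p (fun s => Y ν s ω) := by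
      ext1 β
      rw [Pi.smul_apply, smul_inv_smul₀ hN0.ne']
    rw [h2, h1.fderiv, _root_.smul_apply, inner_smul_right]
    field_simp
  -- D is non-random, so one sample point suffices: one where D + W is negative definite with
  -- constant c and ‖W‖ ≤ c/2. By Markov the second event fails with probability below 1/2 once M/N
  -- < (c/2)²/2.
  have hDneg : ∀ v, inner ℝ v (D v) ≤ -(c / 2) * ‖v‖ ^ 2 := by
    have hmarkov : μ ν {ω | N⁻¹ ^ 2 * S ω < (c / 2) ^ 2}ᶜ < 1 / 2 := by
      have h1 := mul_meas_ge_le_integral_of_nonneg (μ := μ ν) (f := fun ω => N⁻¹ ^ 2 * S ω)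
        (Eventually.of_forall fun ω => (by positivity : (0 : ℝ) ≤ _).trans (hSW ω))
        (hSint.const_mul _) ((c / 2) ^ 2)
      rw [integral_const_mul] at h1
      have h2 : {ω | N⁻¹ ^ 2 * S ω < (c / 2) ^ 2}ᶜ = {ω | (c / 2) ^ 2 ≤ N⁻¹ ^ 2 * S ω} := by
        ext ω; simp
      rw [h2]
      have h3 : N⁻¹ ^ 2 * ∫ ω, S ω ∂(μ ν) < (c / 2) ^ 2 * (1 / 2) := by
        have h4 : N⁻¹ ^ 2 * ∫ ω, S ω ∂(μ ν) ≤ N⁻¹ ^ 2 * (M * N) :=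
          mul_le_mul_of_nonneg_left hSmean (by positivity)
        have h5 : N⁻¹ ^ 2 * (M * N) = M / N := by field_simp
        rw [h5] at h4
        refine h4.trans_lt ?_
        rw [div_lt_iff₀ hN0]
        rw [div_mul_eq_mul_div, div_lt_iff₀ (by positivity)] at hNlarge
        linarith
      have h6 : (μ ν).real {ω | (c / 2) ^ 2 ≤ N⁻¹ ^ 2 * S ω} < 1 / 2 :=
        lt_of_mul_lt_mul_left (h1.trans_lt h3) (by positivity)
      rw [Measure.real, ← ENNReal.lt_ofReal_iff_toReal_lt (measure_ne_top _ _)] at h6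
      refine h6.trans_eq ?_
      rw [ENNReal.ofReal_div_of_pos two_pos]
      simp
    obtain ⟨ω, hω1, hω2⟩ := exists_mem_of_measure_gt_half hνhalf hmarkov
    intro v
    have h1 := hω1 v
    rw [hfderiv, _root_.add_apply, inner_add_right] at h1
    have hω2' : N⁻¹ ^ 2 * S ω < (c / 2) ^ 2 := hω2
    have h2 : ‖W ω‖ ≤ c / 2 := by
      refine abs_le_of_sq_le_sq' ?_ hc2.le |>.2
      have := hSW ω
      nlinarith [sq_nonneg ‖N⁻¹ • quasiScore (T ν) β₀ a ρ p fun s => Y ν s ω‖]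
    have h3 := neg_le_of_abs_le ((abs_real_inner_le_norm v (W ω v)).trans
      (mul_le_mul_of_nonneg_left (((W ω).le_opNorm v).trans
        (mul_le_mul_of_nonneg_right h2 (norm_nonneg v))) (norm_nonneg v)))
    nlinarith
  -- Inverting the non-random D rather than D + W lets J pass through the expectation, so the linear
  -- term has mean zero.
  obtain ⟨J, hJD, -, hJ⟩ := exists_inverse_of_inner_le hc2 hDneg
  have hUint' : Integrable (fun ω => N⁻¹ • quasiScore (T ν) β₀ a ρ p fun s => Y ν s ω) (μ ν) :=
    hUint.smul N⁻¹
  have hgint : Integrable (fun ω => J (N⁻¹ • quasiScore (T ν) β₀ a ρ p fun s => Y ν s ω)) (μ ν) :=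
    J.integrable_comp hUint'
  have hg0 : ∫ ω, J (N⁻¹ • quasiScore (T ν) β₀ a ρ p fun s => Y ν s ω) ∂(μ ν) = 0 := by
    rw [J.integral_comp_comm hUint', integral_smul, hU0, smul_zero, map_zero]
  have hae : ∀ᵐ ω ∂(μ ν), ‖(b ν ω - β₀) + J (N⁻¹ • quasiScore (T ν) β₀ a ρ p fun s => Y ν s ω)‖
      ≤ C * (N⁻¹ ^ 2 * S ω) := by
    filter_upwards [(hb ν).2, hR ν] with ω hω hRω
    refine (hpoint (fun β => N⁻¹ • quasiScore (T ν) β a ρ p fun s => Y ν s ω) D (W ω) J β₀ (b ν ω)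
      hDneg hJD hJ (hexpω ω) ?_ ?_).trans (mul_le_mul_of_nonneg_left (hSW ω) hC)
    · rintro ⟨β, hβ, hβ0⟩
      have h1 := (smul_eq_zero.1 hβ0).resolve_left (inv_ne_zero hN0.ne')
      obtain ⟨h2, h3⟩ := hω ⟨β, hβ, h1⟩
      exact ⟨h2, by simp only [h3, smul_zero]⟩
    · exact (norm_sub_le _ _).trans (by linarith)
  have hfinal := norm_integral_le_of_norm_add_le ((hbint ν).sub (integrable_const β₀)) hgint hg0
    ((hSint.const_mul _).const_mul C) hae
  refine hfinal.trans ?_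
  rw [integral_const_mul, integral_const_mul, norm_div, norm_one, Real.norm_of_nonneg hN0.le]
  calc C * (N⁻¹ ^ 2 * ∫ ω, S ω ∂(μ ν)) ≤ C * (N⁻¹ ^ 2 * (M * N)) :=
        mul_le_mul_of_nonneg_left (mul_le_mul_of_nonneg_left hSmean (by positivity)) hC
    _ = _ := by field_simp
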